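/- Let $X,Y,Z$ be finite sets with $X,Y$ non-empty, let $\mu$ be the uniform distribution on $X\times Y$, and for $f:X\times Y\to Z$ let $$\mathrm{mdisc}(f)=\max_{R}\max_{z\in Z}\bigl|\mu(R\cap f^{-1}(z))-\mu(R)/|Z|\bigr|,$$ where $R$ ranges over all rectangles $A\times B$ with $A\subseteq X$, $B\subseteq Y$. For $l,r\ge 0$ let $f_{l,r}$ be the problem in which Alice is given $x_1,\dots,x_l\in X$, Bob is given $y_1,\dots,y_r\in Y$, and all $l\cdot r$ values $f(x_i,y_j)$ have to be output. A quantum protocol with space $S$ is a pair of communicating quantum circuits working on $S$ qubit cells in total, none of which is in use at the start. Inputs and output values are encoded as bit strings by injective maps. Each player may apply arbitrary unitary operations to the qubits that he holds, query bits of his own input by oracle gates, measure qubits, throw qubits away, pick up fresh qubits in state $|0\rangle$ (stored in unused cells), and send qubits to the other player. For each pair $(i,j)$ there is exactly one, predetermined, output gate: one player measures a register holding the encoding of an element of $Z$ and sends this register to the other player. The communication $C$ is the number of qubits sent, including those that carry the outputs. The protocol computes $f_{l,r}$ with error $\varepsilon$ if, on every input, all $l\cdot r$ outputs are simultaneously correct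 with probability at least $1-\varepsilon$. Theorem. For every $0\le\varepsilon<1/2$ there is a constant $c>0$, depending only on $\varepsilon$, such that for all $f:X\times Y\to Z$ and all real $d$ with $\mathrm{mdisc}(f)\le 2^{-d}$, every quantum protocol with space $S$ that computes $f_{l,r}$ with error $\varepsilon$ has communication $C$ satisfying $$C\cdot S\ \ge\ c\cdot d\,l\,r\,\log_2|Z| ,$$ that is, $C=\Omega(d\,l\,r\log|Z|/S)$. In particular, for Boolean $f:X\times Y\to\{0,1\}$ whose ordinary discrepancy $\mathrm{disc}(f)=\max_R|\mu(R\cap f^{-1}(0))-\mu(R\cap f^{-1}(1))|$ is at most $2^{-d}$, $C\cdot S\ge c\cdot d\,l\,r$. -/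

import Mathlib

universe u₁ u₂ u₃

noncomputable section

namespace CommSpace

/-! ### Discrepancy under the uniform distribution -/

section Discrepancy

variable {X Y Z : Type*} [Fintype X] [Fintype Y]

/-- The uniform measure on `X × Y` of the rectangle `A × B`. -/
def rectMeasure (A : Finset X) (B : Finset Y) : ℝ :=
  ((A ×ˢ B).card : ℝ) / ((Fintype.card X : ℝ) * (Fintype.card Y : ℝ))

open Classical in
/-- The uniform measure on `X × Y` of the part of the rectangle `A × B` on which `f = z`. -/
def colorMeasure (f : X → Y → Z) (A : Finset X) (B : Finset Y) (z : Z) : ℝ :=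
  (((A ×ˢ B).filter (fun p => f p.1 p.2 = z)).card : ℝ) /
    ((Fintype.card X : ℝ) * (Fintype.card Y : ℝ))

/-- Multicolor discrepancy: the maximum over all rectangles `R = A × B` and all colors `z` of
`|μ(R ∩ f⁻¹(z)) - μ(R) / |Z||`. -/
def mdisc [Fintype Z] (f : X → Y → Z) : ℝ :=
  ⨆ p : Finset X × Finset Y × Z,
    |colorMeasure f p.1 p.2.1 p.2.2 - rectMeasure p.1 p.2.1 / (Fintype.card Z : ℝ)|

/-- Discrepancy of a Boolean function: the maximum over all rectangles `R = A × B` of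
`|μ(R ∩ f⁻¹(0)) - μ(R ∩ f⁻¹(1))|`. -/
def disc (f : X → Y → Bool) : ℝ :=
  ⨆ p : Finset X × Finset Y,
    |colorMeasure f p.1 p.2 false - colorMeasure f p.1 p.2 true|

end Discrepancy

/-! ### Communicating quantum circuits -/

/-- The two players. -/
inductive Player
  | alice
  | bob

/-- The opponent of a player. -/
def Player.other : Player → Player
  | .alice => .bob
  | .bob => .alice

/-- Computational basis states of `S` qubits. -/
abbrev Basis (S : ℕ) : Type := Fin S → Bool

/-- Operators on the state space of `S` qubits. -/
abbrev Op (S : ℕ) : Type := Matrix (Basis S) (Basis S) ℂ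

/-- Which player holds each of the `S` qubit cells; `none` means that the cell is not in use. -/
abbrev Ownership (S : ℕ) : Type := Fin S → Option Player

/-- Gates of a pair of communicating circuits with `S` qubit cells in total. Alice's input consists
of `l` blocks of `a` bits, Bob's of `r` blocks of `b` bits, and each of the `l * r` output values is
a string of `w` bits. -/
inductive Gate (l r a b w S : ℕ) : Type
  /-- A local unitary operation of a player on the cells in `T`. -/
  | unitary (P : Player) (T : Finset (Fin S)) (U : Matrix.unitaryGroup (T → Bool) ℂ)
  /-- Alice's oracle gate: the input bit at the position addressed by the cells in `T`
  (in superposition) is added to the cell `q`. -/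
  | queryA (T : Finset (Fin S)) (addr : (T → Bool) → Fin l × Fin a) (q : Fin S)
  /-- Bob's oracle gate. -/
  | queryB (T : Finset (Fin S)) (addr : (T → Bool) → Fin r × Fin b) (q : Fin S)
  /-- A player measures the cell `q` in the computational basis. -/
  | measure (P : Player) (q : Fin S)
  /-- A player picks up a fresh qubit in state `|0⟩`, stored in the unused cell `q`. -/
  | fresh (P : Player) (q : Fin S)
  /-- A player throws the qubit in cell `q` away. -/
  | discard (P : Player) (q : Fin S)
  /-- A player sends the qubit in cell `q` to the other player. -/
  | send (P : Player) (q : Fin S)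
  /-- A player produces the output value for the pair `ij`: the `w` cells of the register `reg`
  are measured in the computational basis, and the value is sent to the other player. -/
  | output (P : Player) (reg : Fin w ↪ Fin S) (ij : Fin l × Fin r)

namespace Gate

variable {l r a b w S : ℕ}

/-- Locality: a player acts only on cells held by that player, and a fresh qubit needs an unused
cell. -/
def Allowed (own : Ownership S) : Gate l r a b w S → Prop
  | unitary P T _ => ∀ t ∈ T, own t = some P
  | queryA T _ q => (∀ t ∈ T, own t = some .alice) ∧ own q = some .alice ∧ q ∉ T
  | queryB T _ q => (∀ t ∈ T, own t = some .bob) ∧ own q = some .bob ∧ q ∉ T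
  | measure P q => own q = some P
  | fresh _ q => own q = none
  | discard P q => own q = some P
  | send P q => own q = some P
  | output P reg _ => ∀ k, own (reg k) = some P

/-- The ownership of the cells after a gate. -/
def next (own : Ownership S) : Gate l r a b w S → Ownership S
  | unitary _ _ _ => own
  | queryA _ _ _ => own
  | queryB _ _ _ => own
  | measure _ _ => own
  | fresh P q => Function.update own q (some P)
  | discard _ q => Function.update own q none
  | send P q => Function.update own q (some P.other)
  | output P reg _ => fun q => if ∃ k, reg k = q then some P.other else own q

/-- The number of qubit wires that cross between the two players at a gate. -/
def cost : Gate l r a b w S → ℕ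
  | send _ _ => 1
  | output _ _ _ => w
  | _ => 0

/-- The pair of indices whose value is output at a gate, if any. -/
def label : Gate l r a b w S → Option (Fin l × Fin r)
  | output _ _ ij => some ij
  | _ => none

end Gate

/-- The operator `U ⊗ 1` on `S` qubits, where `U` acts on the qubits in `T`. -/
def liftOp {S : ℕ} (T : Finset (Fin S)) (U : Matrix (T → Bool) (T → Bool) ℂ) : Op S :=
  Matrix.of fun s t => if ∀ q, q ∉ T → s q = t q then U (fun i => s i) (fun i => t i) else 0

/-- The operator sending the basis state `|s⟩` to the basis state `|φ s⟩`. -/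
def basisMap {S : ℕ} (φ : Basis S → Basis S) : Op S :=
  Matrix.of fun s t => if s = φ t then 1 else 0

/-- The projection onto the span of the basis states satisfying `p`. -/
def basisProj {S : ℕ} (p : Basis S → Prop) [DecidablePred p] : Op S :=
  Matrix.diagonal fun s => if p s then 1 else 0

/-- The oracle operator `|s⟩ ↦ |s⟩` with the bit `s q` replaced by `s q ⊕ (bit at address s|T)`. -/
def queryOp {S : ℕ} {I : Type} (bits : I → Bool) (T : Finset (Fin S)) (addr : (T → Bool) → I)
    (q : Fin S) : Op S :=
  basisMap fun s => Function.update s q (xor (s q) (bits (addr fun i => s i)))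

namespace Gate

variable {l r a b w S : ℕ}

/-- The Kraus operators of a gate, for input bits `bX`, `bY`. At an output gate the measurement
outcome is required to be the string prescribed by `o`, so that only the projection onto this
outcome appears. -/
def kraus (bX : Fin l × Fin a → Bool) (bY : Fin r × Fin b → Bool)
    (o : Fin l × Fin r → Fin w → Bool) : Gate l r a b w S → List (Op S)
  | unitary _ T U => [liftOp T U.1]
  | queryA T addr q => [queryOp bX T addr q]
  | queryB T addr q => [queryOp bY T addr q]
  | measure _ q => [basisProj fun s => s q = false, basisProj fun s => s q = true]
  | fresh _ q =>
      [basisMap (fun s => Function.update s q false) * basisProj fun s => s q = false,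
       basisMap (fun s => Function.update s q false) * basisProj fun s => s q = true]
  | discard _ _ => [1]
  | send _ _ => [1]
  | output _ reg ij => [basisProj fun s => ∀ k, s (reg k) = o ij k]

/-- The effect of a gate on an (unnormalized) density matrix. -/
def apply (bX : Fin l × Fin a → Bool) (bY : Fin r × Fin b → Bool)
    (o : Fin l × Fin r → Fin w → Bool) (g : Gate l r a b w S) (ρ : Op S) : Op S :=
  ((g.kraus bX bY o).map fun K => K * ρ * K.conjTranspose).sum

end Gate

/-- A pair of communicating circuits: a sequence of gates. -/
abbrev Circuit (l r a b w S : ℕ) : Type := List (Gate l r a b w S)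

namespace Circuit

variable {l r a b w S : ℕ}

/-- Every gate of the circuit is local, when the circuit starts with the given ownership. -/
def Valid : Ownership S → Circuit l r a b w S → Prop
  | _, [] => True
  | own, g :: c => g.Allowed own ∧ Valid (g.next own) c

/-- The total communication of a circuit. -/
def comm (c : Circuit l r a b w S) : ℕ := (c.map Gate.cost).sum

/-- The pairs of indices for which outputs are made, in the order of the circuit. -/
def outputs (c : Circuit l r a b w S) : List (Fin l × Fin r) := c.filterMap Gate.label

/-- The unnormalized state after the circuit is run from the state `ρ` and the outcomes at the
output gates are those given by `o`. -/
def run (bX : Fin l × Fin a → Bool) (bY : Fin r × Fin b → Bool)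
    (o : Fin l × Fin r → Fin w → Bool) (c : Circuit l r a b w S) (ρ : Op S) : Op S :=
  c.foldl (fun σ g => g.apply bX bY o σ) ρ

/-- The initial state `|0…0⟩⟨0…0|`. -/
def init (S : ℕ) : Op S := basisProj fun s => s = fun _ => false

/-- The probability that the circuit, started without any qubits in use, outputs at every output
gate the string prescribed by `o`. -/
def outcomeProb (bX : Fin l × Fin a → Bool) (bY : Fin r × Fin b → Bool)
    (o : Fin l × Fin r → Fin w → Bool) (c : Circuit l r a b w S) : ℝ :=
  (Matrix.trace (c.run bX bY o (init S))).re

end Circuit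

/-- A quantum protocol with space `S`, in which Alice gets `x₁, …, x_l ∈ X`, Bob gets
`y₁, …, y_r ∈ Y`, and one value in `Z` is output for each pair `(i, j)`: encodings of inputs and
values by bit strings, and a pair of communicating circuits on `S` qubit cells, without qubits in
use at the start, such that each pair `(i, j)` has exactly one output gate. -/
structure Protocol (X Y Z : Type*) (l r S : ℕ) where
  /-- Length of the encoding of elements of `X`. -/
  a : ℕ
  /-- Length of the encoding of elements of `Y`. -/
  b : ℕ
  /-- Length of the encoding of elements of `Z`. -/
  w : ℕ
  /-- Encoding of Alice's inputs. -/
  encX : X ↪ (Fin a → Bool)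
  /-- Encoding of Bob's inputs. -/
  encY : Y ↪ (Fin b → Bool)
  /-- Encoding of the output values. -/
  encZ : Z ↪ (Fin w → Bool)
  /-- The circuit. -/
  circuit : Circuit l r a b w S
  /-- All gates are local. -/
  valid : circuit.Valid fun _ => none
  /-- Each output is made at exactly one gate. -/
  output_once : ∀ ij, circuit.outputs.count ij = 1

namespace Protocol

variable {X Y Z : Type*} {l r S : ℕ}

/-- The number of qubits communicated, including those that carry the outputs. -/
def comm (Q : Protocol X Y Z l r S) : ℕ := Q.circuit.comm

/-- The probability that, on inputs `x` and `y`, all values `f (x i) (y j)` are output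
correctly. -/
def successProb (Q : Protocol X Y Z l r S) (f : X → Y → Z) (x : Fin l → X) (y : Fin r → Y) : ℝ :=
  Q.circuit.outcomeProb (fun p => Q.encX (x p.1) p.2) (fun p => Q.encY (y p.1) p.2)
    (fun ij => Q.encZ (f (x ij.1) (y ij.2)))

/-- The protocol computes all the values `f (x i) (y j)`, with error probability at most `ε` on
each input. -/
def Computes (Q : Protocol X Y Z l r S) (f : X → Y → Z) (ε : ℝ) : Prop :=
  ∀ (x : Fin l → X) (y : Fin r → Y), 1 - ε ≤ Q.successProb f x y

end Protocol

end CommSpace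

end

/-!
A protocol is cut into segments with communication at most about `d / 8`. The claim is that one
segment makes only `O(S / log |Z|)` outputs; as there are `O(C / d)` segments, the `l * r` outputs
force `C * S = Ω(d * l * r * log |Z|)`. If `d = O(S)` or `d` is below a constant depending on `ε`, the
bound already follows from the communication of the outputs alone.

For a single segment, the state in which it starts is unknown but dominated by the identity, which
is the sum of the `2 ^ S` basis states (`Circuit.trace_run_le_sum_basisState`). So it costs a factor
`2 ^ S` to assume that it starts in a basis state, which is a product state independent of the
inputs. Then, for each prescribed string of outputs, the state stays a signed combination of products
of a state of Alice's cells, depending on her inputs only, and a state of Bob's cells, depending on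
his inputs only: local gates act on one factor, and each qubit sent multiplies the total weight of
the combination by at most `16` (`transfer_decomposition`, `abs_sum_trace_run_le`). Traces of product
states are product functions `a x * b y` with values in `[0, 1]`. Under such a weight the values of
`f` at `k` distinct pairs have probability `|Z| ^ (-k)` up to an error `k * mdisc f`: with all inputs
but `x i` and `y j` fixed, the indicator of correctness at the other pairs is itself a product
function of `x i` and `y j`, so one pair can be removed at a time (`abs_sum_agreeInd_sub_le`).
Summing over the `|Z| ^ k` possible outputs, `k` outputs with communication `n` are right with
probability at most `|Z| ^ (-k) + |Z| ^ k * 16 ^ n * k * mdisc f`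
(`sum_trace_run_basisState_le`). With `n ≤ d / 8` and `k` slightly above `S / log |Z|`, this stays
below `1 / 2` even after multiplication by `2 ^ S`.

A protocol consisting of one short segment starts without qubits in use, so the factor `2 ^ S` is
absent and already one output cannot be right with probability `1 - ε > 1 / 2`.
-/

noncomputable section

namespace CommSpace

/-! ### Discrepancy of products of functions -/

section Agreement

variable {X Y Z : Type*} {l r : ℕ}

open Classical in
/-- The indicator of the event that the values of `f` at the pairs in `L` are those of `u`. -/
def agreeInd (f : X → Y → Z) (u : Fin l × Fin r → Z) (L : List (Fin l × Fin r))
    (x : Fin l → X) (y : Fin r → Y) : ℝ :=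
  if ∀ e ∈ L, f (x e.1) (y e.2) = u e then 1 else 0

lemma agreeInd_nil (f : X → Y → Z) (u : Fin l × Fin r → Z) (x : Fin l → X) (y : Fin r → Y) :
    agreeInd f u [] x y = 1 := by simp [agreeInd]

open Classical in
/-- The deviation of the indicator of `f x y = z` from its ideal mean `1 / |Z|`. -/
def deviation [Fintype Z] (f : X → Y → Z) (z : Z) (x : X) (y : Y) : ℝ :=
  (if f x y = z then 1 else 0) - 1 / (Fintype.card Z : ℝ)

lemma agreeInd_cons [Fintype Z] (f : X → Y → Z) (u : Fin l × Fin r → Z) (e : Fin l × Fin r)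
    (L : List (Fin l × Fin r)) (x : Fin l → X) (y : Fin r → Y) :
    agreeInd f u (e :: L) x y = agreeInd f u L x y *
      (deviation f (u e) (x e.1) (y e.2) + 1 / (Fintype.card Z : ℝ)) := by
  have h := List.forall_mem_cons (p := fun e => f (x e.1) (y e.2) = u e) (a := e) (l := L)
  by_cases h1 : f (x e.1) (y e.2) = u e <;>
  by_cases h2 : ∀ e ∈ L, f (x e.1) (y e.2) = u e
  · rw [agreeInd, agreeInd, deviation, if_pos h2, if_pos h1, if_pos (h.2 ⟨h1, h2⟩)]; ring
  · rw [agreeInd, agreeInd, if_neg h2, if_neg fun h' => h2 (h.1 h').2]; ring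
  · rw [agreeInd, agreeInd, deviation, if_pos h2, if_neg h1, if_neg fun h' => h1 (h.1 h').1]; ring
  · rw [agreeInd, agreeInd, if_neg h2, if_neg fun h' => h2 (h.1 h').2]; ring

end Agreement

section Discrepancy

/-- A linear form is maximal on the cube `[0,1]^X` at the indicator of the set of nonnegative
coefficients. -/
lemma exists_finset_sum_ge {X : Type*} [Fintype X] (α v : X → ℝ) (h0 : ∀ x, 0 ≤ α x)
    (h1 : ∀ x, α x ≤ 1) : ∃ A : Finset X, ∑ x, α x * v x ≤ ∑ x ∈ A, v x := by
  classical
  refine ⟨Finset.univ.filter fun x => 0 ≤ v x, ?_⟩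
  rw [Finset.sum_filter]
  refine Finset.sum_le_sum fun x _ => ?_
  split_ifs with h
  · nlinarith [h0 x, h1 x]
  · nlinarith [h0 x, h1 x]

/-- A bilinear form is extremal on the cube `[0,1]^X × [0,1]^Y` at indicators of rectangles. -/
lemma bilinear_le_of_rect_le {X Y : Type*} [Fintype X] [Fintype Y] (M : X → Y → ℝ) (D : ℝ)
    (hM : ∀ (A : Finset X) (B : Finset Y), ∑ x ∈ A, ∑ y ∈ B, M x y ≤ D)
    (α : X → ℝ) (β : Y → ℝ) (hα : ∀ x, 0 ≤ α x ∧ α x ≤ 1) (hβ : ∀ y, 0 ≤ β y ∧ β y ≤ 1) :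
    ∑ x, ∑ y, α x * β y * M x y ≤ D := by
  obtain ⟨A, hA⟩ := exists_finset_sum_ge α (fun x => ∑ y, β y * M x y)
    (fun x => (hα x).1) (fun x => (hα x).2)
  obtain ⟨B, hB⟩ := exists_finset_sum_ge β (fun y => ∑ x ∈ A, M x y)
    (fun y => (hβ y).1) (fun y => (hβ y).2)
  calc ∑ x, ∑ y, α x * β y * M x y = ∑ x, α x * ∑ y, β y * M x y := by
        simp only [Finset.mul_sum, mul_assoc]
    _ ≤ ∑ x ∈ A, ∑ y, β y * M x y := hA
    _ = ∑ y, β y * ∑ x ∈ A, M x y := by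
        rw [Finset.sum_comm]; simp only [Finset.mul_sum]
    _ ≤ ∑ y ∈ B, ∑ x ∈ A, M x y := hB
    _ = ∑ x ∈ A, ∑ y ∈ B, M x y := Finset.sum_comm
    _ ≤ D := hM A B

variable {X Y Z : Type*} [Fintype X] [Fintype Y]

open Classical in
lemma colorMeasure_eq_sum (f : X → Y → Z) (A : Finset X) (B : Finset Y) (z : Z) :
    colorMeasure f A B z = (∑ x ∈ A, ∑ y ∈ B, if f x y = z then (1 : ℝ) else 0) /
      ((Fintype.card X : ℝ) * (Fintype.card Y : ℝ)) := by
  rw [colorMeasure, ← Finset.sum_product', Finset.card_filter]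
  push_cast
  congr

lemma rectMeasure_eq_sum (A : Finset X) (B : Finset Y) :
    rectMeasure A B = (∑ _x ∈ A, ∑ _y ∈ B, (1 : ℝ)) /
      ((Fintype.card X : ℝ) * (Fintype.card Y : ℝ)) := by
  simp [rectMeasure, Finset.card_product]

/-- For Boolean `f` the two measures of a rectangle deviate from half of its measure by the same
amount, so `mdisc f` is in fact half of `disc f`. -/
lemma mdisc_le_disc (f : X → Y → Bool) : mdisc f ≤ disc f := by
  classical
  have hd0 : 0 ≤ disc f := Real.iSup_nonneg fun _ => abs_nonneg _
  refine Real.iSup_le (fun p => ?_) hd0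
  have h1 : |colorMeasure f p.1 p.2.1 false - colorMeasure f p.1 p.2.1 true| ≤ disc f :=
    le_ciSup (f := fun p : Finset X × Finset Y =>
      |colorMeasure f p.1 p.2 false - colorMeasure f p.1 p.2 true|)
      (Set.finite_range _).bddAbove (p.1, p.2.1)
  have h2 : rectMeasure p.1 p.2.1 =
      colorMeasure f p.1 p.2.1 false + colorMeasure f p.1 p.2.1 true := by
    rw [rectMeasure_eq_sum, colorMeasure_eq_sum, colorMeasure_eq_sum, ← add_div,
      ← Finset.sum_add_distrib]
    congr 1
    refine Finset.sum_congr rfl fun x _ => ?_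
    rw [← Finset.sum_add_distrib]
    refine Finset.sum_congr rfl fun y _ => ?_
    cases f x y <;> simp
  rw [h2]
  refine le_trans ?_ h1
  rw [Fintype.card_bool]
  push_cast
  rw [abs_le']
  rcases abs_cases (colorMeasure f p.1 p.2.1 false - colorMeasure f p.1 p.2.1 true) with h | h <;>
  cases p.2.2 <;> constructor <;> linarith [h.1, h.2]

variable [Fintype Z]

lemma mdisc_nonneg (f : X → Y → Z) : 0 ≤ mdisc f := Real.iSup_nonneg fun _ => abs_nonneg _

lemma abs_sum_deviation_rect_le (f : X → Y → Z) [Nonempty X] [Nonempty Y] (A : Finset X)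
    (B : Finset Y) (z : Z) :
    |∑ x ∈ A, ∑ y ∈ B, deviation f z x y| ≤
      mdisc f * ((Fintype.card X : ℝ) * (Fintype.card Y : ℝ)) := by
  have hpos : (0 : ℝ) < (Fintype.card X : ℝ) * (Fintype.card Y : ℝ) := by
    have := Fintype.card_pos (α := X); have := Fintype.card_pos (α := Y); positivity
  have h : |colorMeasure f A B z - rectMeasure A B / (Fintype.card Z : ℝ)| ≤ mdisc f :=
    le_ciSup (f := fun p : Finset X × Finset Y × Z =>
      |colorMeasure f p.1 p.2.1 p.2.2 - rectMeasure p.1 p.2.1 / (Fintype.card Z : ℝ)|)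
      (Set.finite_range _).bddAbove (A, B, z)
  have e : colorMeasure f A B z - rectMeasure A B / (Fintype.card Z : ℝ) =
      (∑ x ∈ A, ∑ y ∈ B, deviation f z x y) /
        ((Fintype.card X : ℝ) * (Fintype.card Y : ℝ)) := by
    rw [colorMeasure_eq_sum, rectMeasure_eq_sum]
    simp only [deviation, Finset.sum_sub_distrib, Finset.sum_const, nsmul_eq_mul]
    ring
  rw [e, abs_div, abs_of_pos hpos, div_le_iff₀ hpos] at h
  exact h

lemma abs_sum_mul_deviation_le (f : X → Y → Z) [Nonempty X] [Nonempty Y] (z : Z)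
    (α : X → ℝ) (β : Y → ℝ) (hα : ∀ x, 0 ≤ α x ∧ α x ≤ 1) (hβ : ∀ y, 0 ≤ β y ∧ β y ≤ 1) :
    |∑ x, ∑ y, α x * β y * deviation f z x y| ≤
      mdisc f * ((Fintype.card X : ℝ) * (Fintype.card Y : ℝ)) := by
  rw [abs_le']
  constructor
  · exact bilinear_le_of_rect_le _ _
      (fun A B => (le_abs_self _).trans (abs_sum_deviation_rect_le f A B z)) α β hα hβ
  · have := bilinear_le_of_rect_le (fun x y => -deviation f z x y) _
      (fun A B => by
        simp only [Finset.sum_neg_distrib]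
        exact (neg_le_abs _).trans (abs_sum_deviation_rect_le f A B z)) α β hα hβ
    simpa only [mul_neg, Finset.sum_neg_distrib] using this

/-- Resampling one coordinate does not change the average. -/
lemma sum_update {ι X : Type*} [Fintype ι] [DecidableEq ι] [Fintype X] (i : ι)
    (g : (ι → X) → ℝ) :
    ∑ x : ι → X, ∑ t : X, g (Function.update x i t) = Fintype.card X * ∑ x, g x := by
  -- Exchanging the resampled value with the coordinate is an involution.
  let φ : (ι → X) × X → (ι → X) × X := fun p => (Function.update p.1 i p.2, p.1 i)
  have hφ : Function.Involutive φ := by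
    rintro ⟨x, t⟩
    simp [φ]
  calc ∑ x : ι → X, ∑ t : X, g (Function.update x i t)
      = ∑ p : (ι → X) × X, g (φ p).1 := by rw [Fintype.sum_prod_type]
    _ = ∑ p : (ι → X) × X, g p.1 :=
        Equiv.sum_comp (hφ.toPerm) (fun p : (ι → X) × X => g p.1)
    _ = _ := by rw [Fintype.sum_prod_type]; simp [Finset.mul_sum]

variable {l r : ℕ}

/-- When all inputs but `x i` and `y j` are fixed, a product function times the indicator of
agreement at pairs different from `(i, j)` is still a product function. -/
lemma abs_sum_agreeInd_mul_deviation_le (f : X → Y → Z) [Nonempty X] [Nonempty Y]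
    (a : (Fin l → X) → ℝ) (b : (Fin r → Y) → ℝ) (ha : ∀ x, 0 ≤ a x ∧ a x ≤ 1)
    (hb : ∀ y, 0 ≤ b y ∧ b y ≤ 1) (u : Fin l × Fin r → Z) (e : Fin l × Fin r)
    (L : List (Fin l × Fin r)) (he : e ∉ L) :
    |∑ x : Fin l → X, ∑ y : Fin r → Y,
        a x * b y * agreeInd f u L x y * deviation f (u e) (x e.1) (y e.2)| ≤
      mdisc f * ((Fintype.card (Fin l → X) : ℝ) * (Fintype.card (Fin r → Y) : ℝ)) := by
  classical
  obtain ⟨i, j⟩ := e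
  set g : (Fin l → X) → (Fin r → Y) → ℝ := fun x y =>
    a x * b y * agreeInd f u L x y * deviation f (u (i, j)) (x i) (y j) with hg
  have hX : (0 : ℝ) < Fintype.card X := by exact_mod_cast Fintype.card_pos
  have hY : (0 : ℝ) < Fintype.card Y := by exact_mod_cast Fintype.card_pos
  have key : ∀ x y, |∑ s : X, ∑ t : Y, g (Function.update x i s) (Function.update y j t)| ≤
      mdisc f * ((Fintype.card X : ℝ) * (Fintype.card Y : ℝ)) := by
    intro x y
    set α : X → ℝ := fun s => a (Function.update x i s) *
      if ∀ e ∈ L, e.2 ≠ j → f (Function.update x i s e.1) (y e.2) = u e then 1 else 0 with hα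
    set β : Y → ℝ := fun t => b (Function.update y j t) *
      if ∀ e ∈ L, e.2 = j → f (x e.1) (Function.update y j t e.2) = u e then 1 else 0 with hβ
    have h01 : ∀ (c : ℝ) (p : Prop) [Decidable p], 0 ≤ c ∧ c ≤ 1 →
        0 ≤ c * (if p then 1 else 0) ∧ c * (if p then 1 else 0) ≤ 1 := by
      intro c p _ hc
      split_ifs <;> simp [hc]
    have := abs_sum_mul_deviation_le f (u (i, j)) α β (fun s => h01 _ _ (ha _))
      (fun t => h01 _ _ (hb _))
    refine le_of_eq_of_le (congrArg _ (Finset.sum_congr rfl fun s _ =>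
      Finset.sum_congr rfl fun t _ => ?_)) this
    simp only [hg, hα, hβ, Function.update_self]
    have hand : agreeInd f u L (Function.update x i s) (Function.update y j t) =
        (if ∀ e ∈ L, e.2 ≠ j → f (Function.update x i s e.1) (y e.2) = u e then (1 : ℝ) else 0) *
        (if ∀ e ∈ L, e.2 = j → f (x e.1) (Function.update y j t e.2) = u e then 1 else 0) := by
      rw [agreeInd, ite_zero_mul_ite_zero, one_mul]
      refine if_congr ?_ rfl rfl
      rw [← forall₂_and]
      refine forall₂_congr fun e heL => ?_
      by_cases hj : e.2 = j
      · have hi : e.1 ≠ i := fun hi => he (by rwa [show e = (i, j) from Prod.ext hi hj] at heL)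
        simp [hj, Function.update_of_ne hi]
      · simp [hj]
    rw [hand]
    ring
  have hsum : ∑ x : Fin l → X, ∑ y : Fin r → Y,
      ∑ s : X, ∑ t : Y, g (Function.update x i s) (Function.update y j t) =
      ((Fintype.card X : ℝ) * (Fintype.card Y : ℝ)) * ∑ x, ∑ y, g x y := by
    calc _ = ∑ x : Fin l → X, ∑ s : X, ∑ y : Fin r → Y, ∑ t : Y,
          g (Function.update x i s) (Function.update y j t) :=
          Finset.sum_congr rfl fun x _ => Finset.sum_comm
      _ = ∑ x : Fin l → X, ∑ s : X, Fintype.card Y * ∑ y, g (Function.update x i s) y :=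
          Finset.sum_congr rfl fun x _ => Finset.sum_congr rfl fun s _ => sum_update j _
      _ = _ := by
          rw [sum_update i (fun x => (Fintype.card Y : ℝ) * ∑ y, g x y), ← Finset.mul_sum, mul_assoc]
  have hle : |((Fintype.card X : ℝ) * (Fintype.card Y : ℝ)) * ∑ x, ∑ y, g x y| ≤
      (Fintype.card (Fin l → X) : ℝ) * ((Fintype.card (Fin r → Y) : ℝ) *
        (mdisc f * ((Fintype.card X : ℝ) * (Fintype.card Y : ℝ)))) := by
    rw [← hsum]
    refine (Finset.abs_sum_le_sum_abs _ _).trans ?_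
    refine (Finset.sum_le_card_nsmul _ _ _ fun x _ =>
      (Finset.abs_sum_le_sum_abs _ _).trans (Finset.sum_le_card_nsmul _ _ _ fun y _ =>
        key x y)).trans ?_
    simp [nsmul_eq_mul]
  have hXY := mul_pos hX hY
  rw [abs_mul, abs_of_pos hXY] at hle
  refine le_of_mul_le_mul_left (hle.trans (le_of_eq ?_)) hXY
  ring

/-- Under a product weight, the values of `f` at `k` distinct pairs are almost uniform on `Z^k`. -/
lemma abs_sum_agreeInd_sub_le (f : X → Y → Z) [Nonempty X] [Nonempty Y]
    (a : (Fin l → X) → ℝ) (b : (Fin r → Y) → ℝ) (ha : ∀ x, 0 ≤ a x ∧ a x ≤ 1)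
    (hb : ∀ y, 0 ≤ b y ∧ b y ≤ 1) (u : Fin l × Fin r → Z) (L : List (Fin l × Fin r))
    (hL : L.Nodup) :
    |∑ x : Fin l → X, ∑ y : Fin r → Y,
        (agreeInd f u L x y - (1 / (Fintype.card Z : ℝ)) ^ L.length) * (a x * b y)| ≤
      L.length * (mdisc f *
        ((Fintype.card (Fin l → X) : ℝ) * (Fintype.card (Fin r → Y) : ℝ))) := by
  induction L with
  | nil => simp [agreeInd_nil]
  | cons e L ih =>
    rw [List.nodup_cons] at hL
    have h1 := abs_sum_agreeInd_mul_deviation_le f a b ha hb u e L hL.1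
    have h2 := ih hL.2
    set κ : ℝ := 1 / (Fintype.card Z : ℝ) with hκ
    have hκ0 : 0 ≤ κ := by positivity
    have hκ1 : κ ≤ 1 := by
      rw [hκ, one_div]; exact Nat.cast_inv_le_one _
    have split : ∑ x : Fin l → X, ∑ y : Fin r → Y,
        (agreeInd f u (e :: L) x y - κ ^ (e :: L).length) * (a x * b y) =
        (∑ x : Fin l → X, ∑ y : Fin r → Y,
          a x * b y * agreeInd f u L x y * deviation f (u e) (x e.1) (y e.2)) +
        κ * ∑ x : Fin l → X, ∑ y : Fin r → Y,
          (agreeInd f u L x y - κ ^ L.length) * (a x * b y) := by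
      simp only [Finset.mul_sum, ← Finset.sum_add_distrib]
      refine Finset.sum_congr rfl fun x _ => Finset.sum_congr rfl fun y _ => ?_
      rw [agreeInd_cons, List.length_cons, pow_succ]
      ring
    rw [split]
    refine (abs_add_le _ _).trans ?_
    rw [abs_mul, abs_of_nonneg hκ0]
    have h3 := mul_le_of_le_one_left (abs_nonneg (∑ x : Fin l → X, ∑ y : Fin r → Y,
          (agreeInd f u L x y - κ ^ L.length) * (a x * b y))) hκ1
    rw [List.length_cons]
    push_cast
    linarith

end Discrepancy

open Matrix
open scoped ComplexOrder

/-! ### Operators that depend on a set of cells -/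

section LocalOperators

variable {S : ℕ}

/-- The basis state obtained from `s` by flipping the cells marked by `m`. -/
def flipBy (m s : Basis S) : Basis S := fun q => xor (s q) (m q)

lemma flipBy_involutive (m : Basis S) : Function.Involutive (flipBy m) := by
  intro s; funext q; simp [flipBy]

lemma flipBy_eq (s t : Basis S) : flipBy (fun q => xor (s q) (t q)) s = t := by
  funext q; simp [flipBy]

lemma sum_flipBy {M : Type*} [AddCommMonoid M] (m : Basis S) (g : Basis S → M) :
    ∑ s, g (flipBy m s) = ∑ s, g s :=
  Equiv.sum_comp (flipBy_involutive m).toPerm g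

/-- `A` has the form `A' ⊗ J`, where `A'` acts on the cells in `L` and `J` is the all-ones matrix on
the other cells. The condition is on rows only; for Hermitian matrices it passes to columns. -/
def DependsOn (L : Set (Fin S)) (A : Op S) : Prop :=
  ∀ s s' t, (∀ q ∈ L, s q = s' q) → A s t = A s' t

lemma DependsOn.apply_eq {L : Set (Fin S)} {A : Op S} (hA : DependsOn L A) (h : A.IsHermitian)
    {s s' t t' : Basis S} (hs : ∀ q ∈ L, s q = s' q) (ht : ∀ q ∈ L, t q = t' q) :
    A s t = A s' t' := by
  rw [hA s s' t hs, ← h.apply, hA t t' s' ht, h.apply]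

/-- `K` has the form `K' ⊗ 1`, where `K'` acts on the cells in `L`. -/
structure LocalOp (L : Set (Fin S)) (K : Op S) : Prop where
  supp : ∀ s t, K s t ≠ 0 → ∀ q ∉ L, s q = t q
  shift : ∀ m s t, (∀ q ∈ L, m q = false) → K (flipBy m s) (flipBy m t) = K s t

lemma LocalOp.mul {L : Set (Fin S)} {K K' : Op S} (h : LocalOp L K) (h' : LocalOp L K') :
    LocalOp L (K * K') := by
  constructor
  · intro s t hst q hq
    rw [mul_apply] at hst
    obtain ⟨u, -, hu⟩ := Finset.exists_ne_zero_of_sum_ne_zero hst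
    rw [h.supp s u (left_ne_zero_of_mul hu) q hq, h'.supp u t (right_ne_zero_of_mul hu) q hq]
  · intro m s t hm
    rw [mul_apply, mul_apply, ← sum_flipBy m]
    exact Finset.sum_congr rfl fun u _ => by rw [h.shift m _ _ hm, h'.shift m _ _ hm]

lemma localOp_basisMap {L : Set (Fin S)} {φ : Basis S → Basis S}
    (h1 : ∀ s, ∀ q ∉ L, φ s q = s q)
    (h2 : ∀ m s, (∀ q ∈ L, m q = false) → φ (flipBy m s) = flipBy m (φ s)) :
    LocalOp L (basisMap φ) := by
  constructor
  · intro s t hst q hq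
    have : s = φ t := by
      by_contra h
      exact hst (by simp [basisMap, h])
    rw [this, h1 t q hq]
  · intro m s t hm
    simp only [basisMap, of_apply, h2 m t hm, (flipBy_involutive m).injective.eq_iff]

lemma localOp_basisProj {L : Set (Fin S)} {p : Basis S → Prop} [DecidablePred p]
    (h : ∀ m s, (∀ q ∈ L, m q = false) → (p (flipBy m s) ↔ p s)) :
    LocalOp L (basisProj p) := by
  constructor
  · intro s t hst q _
    have : s = t := by
      by_contra hne
      exact hst (by simp [basisProj, hne])
    rw [this]
  · intro m s t hm
    simp only [basisProj, diagonal_apply, (flipBy_involutive m).injective.eq_iff, h m s hm]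

lemma localOp_one (L : Set (Fin S)) : LocalOp L (1 : Op S) := by
  constructor
  · intro s t hst q _
    rw [not_imp_comm.1 (one_apply_ne (i := s) (j := t)) hst]
  · intro m s t _
    simp only [one_apply, (flipBy_involutive m).injective.eq_iff]

lemma localOp_liftOp {L : Set (Fin S)} {T : Finset (Fin S)} (hT : ∀ q ∈ T, q ∈ L)
    (U : Matrix (T → Bool) (T → Bool) ℂ) : LocalOp L (liftOp T U) := by
  constructor
  · intro s t hst q hq
    have : ∀ q, q ∉ T → s q = t q := by
      by_contra h
      exact hst (by simp only [liftOp, of_apply, if_neg h])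
    exact this q fun h => hq (hT q h)
  · intro m s t hm
    have h : ∀ s : Basis S, (fun i : T => flipBy m s i) = fun i : T => s i := fun s => by
      funext i; simp [flipBy, hm i (hT i i.2)]
    simp only [liftOp, of_apply, h]
    simp [flipBy]

lemma localOp_update {L : Set (Fin S)} {q : Fin S} (hq : q ∈ L) (g : Basis S → Bool)
    (hg : ∀ m s, (∀ q ∈ L, m q = false) → g (flipBy m s) = g s) :
    LocalOp L (basisMap fun s => Function.update s q (g s)) := by
  refine localOp_basisMap (fun s q' hq' => ?_) fun m s hm => ?_
  · exact Function.update_of_ne (fun h : q' = q => hq' (by rwa [h])) _ _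
  · rw [hg m s hm]
    funext q'
    by_cases h : q' = q
    · subst h; simp [flipBy, hm _ hq]
    · simp [flipBy, h]

lemma localOp_queryOp {L : Set (Fin S)} {I : Type} (bits : I → Bool) {T : Finset (Fin S)}
    (hT : ∀ q ∈ T, q ∈ L) (addr : (T → Bool) → I) {q : Fin S} (hq : q ∈ L) :
    LocalOp L (queryOp bits T addr q) := by
  refine localOp_update hq _ fun m s hm => ?_
  have h : (fun i : T => flipBy m s i) = fun i : T => s i := by
    funext i; simp [flipBy, hm i (hT i i.2)]
  rw [h]
  simp [flipBy, hm q hq]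

lemma conj_apply (K A : Op S) (s t : Basis S) :
    (K * A * Kᴴ) s t = ∑ t', (∑ s', K s s' * A s' t') * star (K t t') := by
  simp [mul_apply, conjTranspose_apply]

/-- A local operator of one player acts on that player's factor of a product state. -/
lemma LocalOp.conj_hadamard {L : Set (Fin S)} {K A B : Op S} (hK : LocalOp L K)
    (hB : DependsOn Lᶜ B) (hB' : B.IsHermitian) :
    K * (A ⊙ B) * Kᴴ = (K * A * Kᴴ) ⊙ B := by
  ext s t
  rw [hadamard_apply, conj_apply, conj_apply, Finset.sum_mul]
  refine Finset.sum_congr rfl fun t' _ => ?_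
  rw [Finset.sum_mul, Finset.sum_mul, Finset.sum_mul]
  refine Finset.sum_congr rfl fun s' _ => ?_
  by_cases h1 : K s s' = 0
  · simp [h1]
  by_cases h2 : K t t' = 0
  · simp [h2]
  rw [hadamard_apply, hB.apply_eq hB' (fun q hq => (hK.supp s s' h1 q hq).symm)
    (fun q hq => (hK.supp t t' h2 q hq).symm)]
  ring

lemma LocalOp.conj_dependsOn {L : Set (Fin S)} {K A : Op S} (hK : LocalOp L K)
    (hA : DependsOn L A) : DependsOn L (K * A * Kᴴ) := by
  intro s s' t hs
  rw [conj_apply, conj_apply]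
  refine Finset.sum_congr rfl fun t' _ => ?_
  congr 1
  -- Flipping the cells where `s` and `s'` differ, all of them outside `L`, commutes with `K`.
  set m : Basis S := fun q => xor (s q) (s' q) with hm
  have hmL : ∀ q ∈ L, m q = false := fun q hq => by simp [hm, hs q hq]
  rw [← flipBy_eq s s', ← sum_flipBy m (fun u => K (flipBy m s) u * A u t')]
  refine Finset.sum_congr rfl fun u _ => ?_
  rw [hK.shift m s u hmL, hA (flipBy m u) u t' fun q hq => by simp [flipBy, hmL q hq]]

/-- An unnormalized state of the cells in `L`, tensored with the all-ones matrix on the other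
cells. -/
structure LocalState (L : Set (Fin S)) (A : Op S) : Prop where
  psd : A.PosSemidef
  trace_le : A.trace.re ≤ 1
  dep : DependsOn L A

lemma trace_re_nonneg {A : Op S} (hA : A.PosSemidef) : 0 ≤ A.trace.re :=
  (Complex.nonneg_iff.1 hA.trace_nonneg).1

lemma trace_eq_re {A : Op S} (hA : A.PosSemidef) : A.trace = (A.trace.re : ℂ) := by
  apply Complex.ext
  · simp
  · simpa using (Complex.nonneg_iff.1 hA.trace_nonneg).2.symm

/-- For states on complementary sets of cells the trace is multiplicative, up to the dimension
coming from the padding with all-ones matrices. -/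
lemma two_pow_mul_trace_hadamard {L : Set (Fin S)} {A B : Op S} (hA : DependsOn L A)
    (hA' : A.IsHermitian) (hB : DependsOn Lᶜ B) (hB' : B.IsHermitian) :
    (2 : ℂ) ^ S * (A ⊙ B).trace = A.trace * B.trace := by
  classical
  -- Exchanging the cells outside `L` of two basis states is an involution.
  let φ : Basis S × Basis S → Basis S × Basis S := fun p =>
    (fun q => if q ∈ L then p.1 q else p.2 q, fun q => if q ∈ L then p.2 q else p.1 q)
  have hφ : Function.Involutive φ := by
    rintro ⟨s, t⟩
    ext q <;> by_cases hq : q ∈ L <;> simp [φ, hq]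
  symm
  calc A.trace * B.trace = ∑ p : Basis S × Basis S, A p.1 p.1 * B p.2 p.2 := by
        rw [Fintype.sum_prod_type, trace, trace, Finset.sum_mul_sum]; rfl
    _ = ∑ p : Basis S × Basis S, A (φ p).1 (φ p).1 * B (φ p).1 (φ p).1 := by
        refine Finset.sum_congr rfl fun p _ => ?_
        have h1 : ∀ q ∈ L, p.1 q = (φ p).1 q := fun q hq => by simp [φ, hq]
        have h2 : ∀ q ∈ Lᶜ, p.2 q = (φ p).1 q := fun q hq => by
          simp [φ, (Set.mem_compl_iff _ _).1 hq]
        rw [hA.apply_eq hA' h1 h1, hB.apply_eq hB' h2 h2]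
    _ = ∑ p : Basis S × Basis S, A p.1 p.1 * B p.1 p.1 :=
        Equiv.sum_comp hφ.toPerm (fun p : Basis S × Basis S => A p.1 p.1 * B p.1 p.1)
    _ = _ := by
        rw [Fintype.sum_prod_type]
        simp [trace, Finset.mul_sum]

lemma hadamard_trace_re {L : Set (Fin S)} {A B : Op S} (hA : LocalState L A)
    (hB : LocalState Lᶜ B) :
    (((2 : ℂ) ^ S • (A ⊙ B)).trace).re = A.trace.re * B.trace.re := by
  rw [trace_smul, smul_eq_mul, two_pow_mul_trace_hadamard hA.dep hA.psd.1 hB.dep hB.psd.1,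
    trace_eq_re hA.psd, trace_eq_re hB.psd, ← Complex.ofReal_mul]
  simp

/-- The effect of a list of Kraus operators on an unnormalized density matrix. -/
def krausMap (Ks : List (Op S)) (ρ : Op S) : Op S := (Ks.map fun K => K * ρ * Kᴴ).sum

@[simp] lemma krausMap_nil (ρ : Op S) : krausMap [] ρ = 0 := rfl

@[simp] lemma krausMap_cons (K : Op S) (Ks : List (Op S)) (ρ : Op S) :
    krausMap (K :: Ks) ρ = K * ρ * Kᴴ + krausMap Ks ρ := by simp [krausMap]

lemma krausMap_add (Ks : List (Op S)) (ρ σ : Op S) :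
    krausMap Ks (ρ + σ) = krausMap Ks ρ + krausMap Ks σ := by
  induction Ks with
  | nil => simp
  | cons K Ks ih => simp only [krausMap_cons, ih, mul_add, add_mul]; abel

lemma krausMap_smul (Ks : List (Op S)) (c : ℂ) (ρ : Op S) :
    krausMap Ks (c • ρ) = c • krausMap Ks ρ := by
  induction Ks with
  | nil => simp
  | cons K Ks ih => simp only [krausMap_cons, ih, Matrix.mul_smul, Matrix.smul_mul, smul_add]

lemma krausMap_posSemidef (Ks : List (Op S)) {ρ : Op S} (h : ρ.PosSemidef) :
    (krausMap Ks ρ).PosSemidef := by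
  induction Ks with
  | nil => exact PosSemidef.zero
  | cons K Ks ih =>
    rw [krausMap_cons]
    exact (h.mul_mul_conjTranspose_same K).add ih

lemma krausMap_hadamard {L : Set (Fin S)} {A B : Op S} (Ks : List (Op S))
    (hK : ∀ K ∈ Ks, LocalOp L K) (hB : DependsOn Lᶜ B) (hB' : B.IsHermitian) :
    krausMap Ks (A ⊙ B) = krausMap Ks A ⊙ B := by
  induction Ks with
  | nil => simp
  | cons K Ks ih =>
    rw [List.forall_mem_cons] at hK
    rw [krausMap_cons, krausMap_cons, add_hadamard, ih hK.2, hK.1.conj_hadamard hB hB']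

lemma krausMap_dependsOn {L : Set (Fin S)} {A : Op S} (Ks : List (Op S))
    (hK : ∀ K ∈ Ks, LocalOp L K) (hA : DependsOn L A) : DependsOn L (krausMap Ks A) := by
  induction Ks with
  | nil => intro s s' t _; simp
  | cons K Ks ih =>
    rw [List.forall_mem_cons] at hK
    intro s s' t hs
    rw [krausMap_cons, Matrix.add_apply, Matrix.add_apply, hK.1.conj_dependsOn hA s s' t hs, ih hK.2 s s' t hs]

/-- The trace of `∑ K ρ K†` is that of `(∑ K† K) ρ`. -/
lemma trace_krausMap (Ks : List (Op S)) (ρ : Op S) :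
    (krausMap Ks ρ).trace = ((Ks.map fun K => Kᴴ * K).sum * ρ).trace := by
  induction Ks with
  | nil => simp
  | cons K Ks ih =>
    rw [krausMap_cons, trace_add, ih, List.map_cons, List.sum_cons, add_mul, trace_add,
      trace_mul_cycle]

end LocalOperators

/-! ### Moving a cell from one player to the other -/

section Transfer

variable {S : ℕ}

/-- The diagonal operator multiplying `|s⟩` by `v (s q)`. -/
def cellDiag (q : Fin S) (v : Bool → ℂ) : Op S := diagonal fun s => v (s q)

lemma cellDiag_conj_apply (q : Fin S) (v : Bool → ℂ) (A : Op S) (s t : Basis S) :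
    (cellDiag q v * A * (cellDiag q v)ᴴ) s t = v (s q) * A s t * star (v (t q)) := by
  simp [cellDiag, diagonal_conjTranspose, mul_diagonal, diagonal_mul]

lemma sum_update_cell (q : Fin S) (g : Basis S → ℝ) :
    ∑ s : Basis S, (g (Function.update s q true) + g (Function.update s q false)) =
      2 * ∑ s, g s := by
  have := sum_update (X := Bool) q g
  simpa using this

lemma re_diag_nonneg {A : Op S} (hA : A.PosSemidef) (s : Basis S) : 0 ≤ (A s s).re :=
  (Complex.nonneg_iff.1 hA.diag_nonneg).1

lemma trace_re_eq (A : Op S) : A.trace.re = ∑ s, (A s s).re := by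
  simp [trace]

lemma trace_cellDiag_conj_le (q : Fin S) (v : Bool → ℂ) (hv : ∀ e, ‖v e‖ ≤ 1) {A : Op S}
    (hA : A.PosSemidef) : (cellDiag q v * A * (cellDiag q v)ᴴ).trace.re ≤ A.trace.re := by
  rw [trace_re_eq, trace_re_eq]
  refine Finset.sum_le_sum fun s _ => ?_
  have h : v (s q) * A s s * star (v (s q)) = ((‖v (s q)‖ ^ 2 : ℝ) : ℂ) * A s s := by
    have := Complex.mul_conj (v (s q))
    rw [Complex.normSq_eq_norm_sq] at this
    rw [← this, Complex.star_def]
    ring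
  rw [cellDiag_conj_apply, h, Complex.re_ofReal_mul]
  exact mul_le_of_le_one_left (re_diag_nonneg hA s) (pow_le_one₀ (norm_nonneg _) (hv _))

/-- The matrix with rows `⟨s|` summed over both values of the cell `q`. -/
def cellSum (q : Fin S) : Op S :=
  of fun s s' => ∑ e : Bool, if s' = Function.update s q e then 1 else 0

/-- The cell `q` is contracted with the all-ones vector on both sides, and the result is padded
with the all-ones matrix in this cell. -/
def contract (q : Fin S) (A : Op S) : Op S := cellSum q * A * (cellSum q)ᴴ

lemma contract_apply (q : Fin S) (A : Op S) (s t : Basis S) :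
    contract q A s t = ∑ e : Bool, ∑ f : Bool, A (Function.update s q e)
      (Function.update t q f) := by
  rw [contract, conj_apply]
  simp only [cellSum, of_apply, star_sum, Finset.sum_mul, Finset.mul_sum]
  simp [ite_mul, Finset.sum_add_distrib]

lemma contract_posSemidef (q : Fin S) {A : Op S} (hA : A.PosSemidef) :
    (contract q A).PosSemidef := hA.mul_mul_conjTranspose_same _

lemma contract_dependsOn {L : Set (Fin S)} (q : Fin S) {A : Op S} (hA : DependsOn L A) :
    DependsOn (L \ {q}) (contract q A) := by
  intro s s' t hs
  rw [contract_apply, contract_apply]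
  refine Finset.sum_congr rfl fun e _ => Finset.sum_congr rfl fun f _ => hA _ _ _ fun q' hq' => ?_
  by_cases h : q' = q
  · subst h; simp
  · simp [h, hs q' ⟨hq', h⟩]

lemma re_offdiag_add_le {A : Op S} (hA : A.PosSemidef) (s t : Basis S) :
    (A s t).re + (A t s).re ≤ (A s s).re + (A t t).re := by
  by_cases hst : s = t
  · rw [hst]
  have h := hA.dotProduct_mulVec_nonneg (Pi.single s 1 - Pi.single t 1)
  have h' := (Complex.nonneg_iff.1 h).1
  simp [sub_dotProduct, mulVec_sub, dotProduct_sub, Pi.star_single] at h'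
  linarith

lemma trace_contract_le (q : Fin S) {A : Op S} (hA : A.PosSemidef) :
    (contract q A).trace.re ≤ 4 * A.trace.re := by
  rw [trace_re_eq, trace_re_eq, show (4 : ℝ) = 2 * 2 by norm_num, mul_assoc,
    ← sum_update_cell q, Finset.mul_sum]
  refine Finset.sum_le_sum fun s _ => ?_
  have := re_offdiag_add_le hA (Function.update s q true) (Function.update s q false)
  simp only [contract_apply, Fintype.sum_bool, Complex.add_re]
  linarith

/-- Weighted contraction of a cell, normalized so as not to increase the trace. -/
def giveCell (q : Fin S) (v : Bool → ℂ) (A : Op S) : Op S :=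
  (1 / 4 : ℂ) • contract q (cellDiag q v * A * (cellDiag q v)ᴴ)

lemma posSemidef_smul_ofReal {A : Op S} (hA : A.PosSemidef) {c : ℝ} (hc : 0 ≤ c) :
    ((c : ℂ) • A).PosSemidef :=
  hA.smul (by exact_mod_cast hc)

lemma cellDiag_conj_dependsOn {L : Set (Fin S)} {q : Fin S} (v : Bool → ℂ) {A : Op S}
    (hA : DependsOn L A) : DependsOn (insert q L) (cellDiag q v * A * (cellDiag q v)ᴴ) := by
  intro s s' t hs
  rw [cellDiag_conj_apply, cellDiag_conj_apply, hs q (Set.mem_insert _ _),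
    hA s s' t fun q' hq' => hs q' (Set.mem_insert_of_mem _ hq')]

lemma LocalState.giveCell {L : Set (Fin S)} {A : Op S} (hA : LocalState L A) {q : Fin S}
    {v : Bool → ℂ} (hv : ∀ e, ‖v e‖ ≤ 1) :
    LocalState (L \ {q}) (giveCell q v A) where
  psd := by
    have := posSemidef_smul_ofReal (contract_posSemidef q
      (hA.psd.mul_mul_conjTranspose_same (cellDiag q v))) (c := 1 / 4) (by norm_num)
    simpa [CommSpace.giveCell] using this
  trace_le := by
    have h1 := trace_contract_le q (hA.psd.mul_mul_conjTranspose_same (cellDiag q v))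
    have h2 := trace_cellDiag_conj_le q v hv hA.psd
    have h3 := hA.trace_le
    have h4 : (CommSpace.giveCell q v A).trace.re =
        1 / 4 * (contract q (cellDiag q v * A * (cellDiag q v)ᴴ)).trace.re := by
      rw [CommSpace.giveCell, trace_smul, smul_eq_mul,
        show (1 / 4 : ℂ) = ((1 / 4 : ℝ) : ℂ) by norm_num, Complex.re_ofReal_mul]
    linarith
  dep := by
    have h := contract_dependsOn q (cellDiag_conj_dependsOn (q := q) v hA.dep)
    intro s s' t hs
    rw [CommSpace.giveCell, Matrix.smul_apply, Matrix.smul_apply, h s s' t fun q' hq' => hs q'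
      ⟨Set.mem_of_mem_insert_of_ne hq'.1 hq'.2, hq'.2⟩]

lemma LocalState.takeCell {L : Set (Fin S)} {A : Op S} (hA : LocalState L A) {q : Fin S}
    {v : Bool → ℂ} (hv : ∀ e, ‖v e‖ ≤ 1) :
    LocalState (insert q L) (cellDiag q v * A * (cellDiag q v)ᴴ) where
  psd := hA.psd.mul_mul_conjTranspose_same _
  trace_le := (trace_cellDiag_conj_le q v hv hA.psd).trans hA.trace_le
  dep := cellDiag_conj_dependsOn v hA.dep

/-- The vector `(1, z)`. -/
def phaseVec (z : ℂ) (e : Bool) : ℂ := if e then z else 1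

/-- The basis vector `e₀`. -/
def unitVec (e₀ e : Bool) : ℂ := if e = e₀ then 1 else 0

lemma norm_phaseVec_le {z : ℂ} (hz : ‖z‖ = 1) (e : Bool) : ‖phaseVec z e‖ ≤ 1 := by
  cases e <;> simp [phaseVec, hz]

lemma norm_unitVec_le (e₀ e : Bool) : ‖unitVec e₀ e‖ ≤ 1 := by
  cases e <;> cases e₀ <;> simp [unitVec]

/-- The term of `transfer_decomposition` in which the giver tests the cell against the vector `v`
and the receiver prepares it in the state `w`. -/
def transferTerm (q : Fin S) (v w : Bool → ℂ) (A B : Op S) : Op S :=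
  giveCell q v A ⊙ (cellDiag q w * B * (cellDiag q w)ᴴ)

/-- Sending a qubit is a signed combination of six ways to measure it, send the outcome and prepare
a new qubit. Averaging over the phases `z = ±1, ±i` reproduces the off-diagonal blocks; it yields
the full partial trace in the diagonal ones, from which the wrong terms are subtracted. The giver's
phase is the complex conjugate of the receiver's; the factors `4` make up for the normalization of
`giveCell`. -/
lemma transfer_decomposition (q : Fin S) (A B : Op S) :
    A ⊙ B = transferTerm q (phaseVec 1) (phaseVec 1) A B +
      transferTerm q (phaseVec (-1)) (phaseVec (-1)) A B +
      transferTerm q (phaseVec (-Complex.I)) (phaseVec Complex.I) A B +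
      transferTerm q (phaseVec Complex.I) (phaseVec (-Complex.I)) A B -
      (4 : ℂ) • transferTerm q (unitVec false) (unitVec true) A B -
      (4 : ℂ) • transferTerm q (unitVec true) (unitVec false) A B := by
  ext s t
  simp only [transferTerm, giveCell, hadamard_apply, Matrix.add_apply, Matrix.sub_apply,
    Matrix.smul_apply, smul_eq_mul, contract_apply, cellDiag_conj_apply, Fintype.sum_bool,
    Function.update_self]
  have h : A s t = A (Function.update s q (s q)) (Function.update t q (t q)) := by simp
  rw [h]
  rcases s q with _ | _ <;> rcases t q with _ | _ <;>
    simp [phaseVec, unitVec] <;> ring_nf <;>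
    simp only [Complex.I_sq, Complex.I_pow_four] <;> ring

/-- The giver's part when a cell in state `|0⟩` changes hands. -/
def giveZeroCell (q : Fin S) (A : Op S) : Op S := ((1 / 2 : ℝ) : ℂ) • contract q A

/-- The receiver's part when a cell in state `|0⟩` changes hands. -/
def takeZeroCell (q : Fin S) (B : Op S) : Op S :=
  ((2 : ℝ) : ℂ) • (cellDiag q (unitVec false) * B * (cellDiag q (unitVec false))ᴴ)

lemma contract_apply_of_zero {q : Fin S} {A : Op S}
    (hzero : ∀ s t, A s t ≠ 0 → s q = false ∧ t q = false) (s t : Basis S) :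
    contract q A s t = A (Function.update s q false) (Function.update t q false) := by
  rw [contract_apply]
  have h : ∀ e f, (e = true ∨ f = true) →
      A (Function.update s q e) (Function.update t q f) = 0 := by
    intro e f hef
    by_contra hne
    have := hzero _ _ hne
    simp only [Function.update_self] at this
    rcases hef with h | h <;> simp [h] at this
  simp [h]

lemma LocalState.giveZeroCell {L : Set (Fin S)} {q : Fin S} {A : Op S} (hA : LocalState L A)
    (hzero : ∀ s t, A s t ≠ 0 → s q = false ∧ t q = false) :
    LocalState (L \ {q}) (giveZeroCell q A) where
  psd := posSemidef_smul_ofReal (contract_posSemidef q hA.psd) (by norm_num)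
  trace_le := by
    rw [CommSpace.giveZeroCell, trace_smul, smul_eq_mul, Complex.re_ofReal_mul]
    have h := sum_update_cell q fun s => (A s s).re
    have h1 : (contract q A).trace.re ≤ 2 * A.trace.re := by
      rw [trace_re_eq, trace_re_eq, ← h]
      refine Finset.sum_le_sum fun s _ => ?_
      rw [contract_apply_of_zero hzero]
      linarith [re_diag_nonneg hA.psd (Function.update s q true)]
    linarith [hA.trace_le]
  dep := by
    intro s s' t hs
    rw [CommSpace.giveZeroCell, Matrix.smul_apply, Matrix.smul_apply,
      contract_dependsOn q hA.dep s s' t hs]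

lemma LocalState.takeZeroCell {L : Set (Fin S)} {q : Fin S} {B : Op S} (hB : LocalState L B)
    (hq : q ∉ L) : LocalState (insert q L) (takeZeroCell q B) where
  psd := posSemidef_smul_ofReal (hB.psd.mul_mul_conjTranspose_same _) (by norm_num)
  trace_le := by
    rw [CommSpace.takeZeroCell, trace_smul, smul_eq_mul, Complex.re_ofReal_mul, trace_re_eq,
      ← sum_update_cell q]
    refine le_trans (le_of_eq ?_) hB.trace_le
    rw [trace_re_eq]
    refine Finset.sum_congr rfl fun s _ => ?_
    have hs : ∀ q' ∈ L, Function.update s q false q' = s q' := fun q' hq' =>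
      Function.update_of_ne (fun h : q' = q => hq (by rwa [← h])) _ _
    simp only [cellDiag_conj_apply, Function.update_self]
    rw [hB.dep.apply_eq hB.psd.1 hs hs]
    simp [unitVec]
  dep := by
    intro s s' t hs
    rw [CommSpace.takeZeroCell, Matrix.smul_apply, Matrix.smul_apply,
      cellDiag_conj_dependsOn _ hB.dep s s' t hs]

/-- A cell in state `|0⟩` can change hands at no cost. -/
lemma hadamard_eq_zeroCell {q : Fin S} {A : Op S} (B : Op S)
    (hzero : ∀ s t, A s t ≠ 0 → s q = false ∧ t q = false) :
    A ⊙ B = giveZeroCell q A ⊙ takeZeroCell q B := by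
  ext s t
  simp only [giveZeroCell, takeZeroCell, hadamard_apply, Matrix.smul_apply,
    contract_apply_of_zero hzero, cellDiag_conj_apply, smul_eq_mul]
  by_cases h : s q = false ∧ t q = false
  · rw [Function.update_eq_self_iff.2 h.1.symm, Function.update_eq_self_iff.2 h.2.symm, h.1, h.2]
    simp [unitVec]
    ring
  · rw [not_imp_comm.1 (hzero s t) h]
    rcases not_and_or.1 h with h | h <;> simp [unitVec, h]

end Transfer

/-! ### Gates do not increase the trace -/

section GateTrace

variable {l r a b w S : ℕ}

lemma basisMap_isometry {φ : Basis S → Basis S} (hφ : Function.Injective φ) :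
    (basisMap φ)ᴴ * basisMap φ = 1 := by
  ext s t
  simp [mul_apply, basisMap, one_apply, hφ.eq_iff, eq_comm]

lemma queryOp_isometry {I : Type} (bits : I → Bool) (T : Finset (Fin S)) (addr : (T → Bool) → I)
    {q : Fin S} (hq : q ∉ T) : (queryOp bits T addr q)ᴴ * queryOp bits T addr q = 1 := by
  refine basisMap_isometry (Function.Involutive.injective fun s => ?_)
  have h : (fun i : T => Function.update s q (xor (s q) (bits (addr fun i => s i))) i) =
      fun i : T => s i := by
    funext i
    exact Function.update_of_ne (fun h : (i : Fin S) = q => hq (h ▸ i.2)) _ _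
  simp [h]

lemma liftOp_eq_submatrix (T : Finset (Fin S)) (U : Matrix (T → Bool) (T → Bool) ℂ) :
    liftOp T U = (kroneckerMap (· * ·) U
      (1 : Matrix ({q // q ∉ T} → Bool) ({q // q ∉ T} → Bool) ℂ)).submatrix
        (Equiv.piEquivPiSubtypeProd (· ∈ T) fun _ => Bool)
        (Equiv.piEquivPiSubtypeProd (· ∈ T) fun _ => Bool) := by
  ext s t
  simp [liftOp, one_apply, funext_iff]

lemma liftOp_isometry (T : Finset (Fin S)) (U : Matrix.unitaryGroup (T → Bool) ℂ) :
    (liftOp T U.1)ᴴ * liftOp T U.1 = 1 := by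
  have hU : U.1ᴴ * U.1 = 1 := Matrix.mem_unitaryGroup_iff'.1 U.2
  rw [liftOp_eq_submatrix, conjTranspose_submatrix, submatrix_mul_equiv, conjTranspose_kronecker,
    ← mul_kronecker_mul, hU]
  simp

lemma basisProj_conjTranspose_mul_self (p : Basis S → Prop) [DecidablePred p] :
    (basisProj p)ᴴ * basisProj p = basisProj p := by
  rw [basisProj, diagonal_conjTranspose, diagonal_mul_diagonal]
  congr 1
  funext s
  by_cases h : p s <;> simp [h]

lemma reset_conjTranspose_mul_self (q : Fin S) (e : Bool) :
    (basisMap (fun s => Function.update s q false) * basisProj (fun s : Basis S => s q = e))ᴴ *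
      (basisMap (fun s => Function.update s q false) * basisProj fun s => s q = e) =
      basisProj fun s => s q = e := by
  ext s t
  simp only [mul_apply, conjTranspose_apply, basisProj, basisMap, of_apply, diagonal_apply]
  by_cases hs : s q = e
  · by_cases ht : t q = e
    · have hst : Function.update s q false = Function.update t q false ↔ s = t := by
        refine ⟨fun h => ?_, fun h => by rw [h]⟩
        funext q'
        by_cases hq' : q' = q
        · rw [hq', hs, ht]
        · simpa [hq'] using congrFun h q'
      simp [hs, ht, hst, eq_comm]
    · have hst : s ≠ t := fun h => ht (h ▸ hs)
      simp [ht, hst]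
  · simp [hs]

lemma basisProj_false_add_true (q : Fin S) :
    (basisProj fun s : Basis S => s q = false) + (basisProj fun s => s q = true) = 1 := by
  rw [basisProj, basisProj, diagonal_add, ← diagonal_one]
  congr 1
  funext s
  cases s q <;> simp

/-- All gates but the output gates are trace preserving. -/
lemma Gate.sum_kraus_eq_one {bX : Fin l × Fin a → Bool} {bY : Fin r × Fin b → Bool}
    {o : Fin l × Fin r → Fin w → Bool} {own : Ownership S} {g : Gate l r a b w S}
    (hg : g.Allowed own) (hl : g.label = none) :
    ((g.kraus bX bY o).map fun K => Kᴴ * K).sum = 1 := by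
  cases g with
  | unitary P T U => simp [Gate.kraus, liftOp_isometry]
  | queryA T addr q => simp [Gate.kraus, queryOp_isometry _ _ _ hg.2.2]
  | queryB T addr q => simp [Gate.kraus, queryOp_isometry _ _ _ hg.2.2]
  | measure P q =>
    simp only [Gate.kraus, List.map_cons, List.map_nil, List.sum_cons, List.sum_nil, add_zero,
      basisProj_conjTranspose_mul_self, basisProj_false_add_true]
  | fresh P q =>
    simp only [Gate.kraus, List.map_cons, List.map_nil, List.sum_cons, List.sum_nil, add_zero,
      reset_conjTranspose_mul_self, basisProj_false_add_true]
  | discard P q => simp [Gate.kraus]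
  | send P q => simp [Gate.kraus]
  | output P reg ij => simp [Gate.label] at hl

lemma Gate.trace_apply_eq {bX : Fin l × Fin a → Bool} {bY : Fin r × Fin b → Bool}
    {o : Fin l × Fin r → Fin w → Bool} {own : Ownership S} {g : Gate l r a b w S}
    (hg : g.Allowed own) (hl : g.label = none) (ρ : Op S) :
    (g.apply bX bY o ρ).trace = ρ.trace := by
  change (krausMap _ ρ).trace = _
  rw [trace_krausMap, Gate.sum_kraus_eq_one hg hl, one_mul]

lemma trace_output_apply (bX : Fin l × Fin a → Bool) (bY : Fin r × Fin b → Bool)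
    (o : Fin l × Fin r → Fin w → Bool) (P : Player) (reg : Fin w ↪ Fin S) (ij : Fin l × Fin r)
    (ρ : Op S) :
    ((Gate.output P reg ij : Gate l r a b w S).apply bX bY o ρ).trace.re =
      ∑ s, if ∀ k, s (reg k) = o ij k then (ρ s s).re else 0 := by
  change (krausMap _ ρ).trace.re = _
  rw [trace_krausMap]
  simp only [Gate.kraus, List.map_cons, List.map_nil, List.sum_cons, List.sum_nil, add_zero,
    basisProj_conjTranspose_mul_self]
  rw [trace_re_eq]
  refine Finset.sum_congr rfl fun s _ => ?_
  rw [basisProj, diagonal_mul]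
  split_ifs <;> simp

lemma Gate.trace_apply_le {bX : Fin l × Fin a → Bool} {bY : Fin r × Fin b → Bool}
    {o : Fin l × Fin r → Fin w → Bool} {own : Ownership S} {g : Gate l r a b w S}
    (hg : g.Allowed own) {ρ : Op S} (hρ : ρ.PosSemidef) :
    (g.apply bX bY o ρ).trace.re ≤ ρ.trace.re := by
  rcases hl : g.label with _ | ij
  · rw [Gate.trace_apply_eq hg hl]
  · cases g with
    | output P reg ij =>
      rw [trace_output_apply, trace_re_eq]
      refine Finset.sum_le_sum fun s _ => ?_
      split_ifs
      · exact le_rfl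
      · exact re_diag_nonneg hρ s
    | _ => simp [Gate.label] at hl

lemma Gate.apply_posSemidef (bX : Fin l × Fin a → Bool) (bY : Fin r × Fin b → Bool)
    (o : Fin l × Fin r → Fin w → Bool) (g : Gate l r a b w S) {ρ : Op S} (hρ : ρ.PosSemidef) :
    (g.apply bX bY o ρ).PosSemidef := krausMap_posSemidef _ hρ

lemma Gate.apply_congr {bX : Fin l × Fin a → Bool} {bY : Fin r × Fin b → Bool}
    {o o' : Fin l × Fin r → Fin w → Bool} {g : Gate l r a b w S}
    (h : ∀ ij, g.label = some ij → o ij = o' ij) (ρ : Op S) :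
    g.apply bX bY o ρ = g.apply bX bY o' ρ := by
  cases g with
  | output P reg ij => simp only [Gate.apply, Gate.kraus]; rw [h ij rfl]
  | _ => rfl

/-- The outcomes of an output gate that encode distinct values exclude each other. -/
lemma sum_trace_output_apply_le {Z : Type*} [Fintype Z] (enc : Z ↪ (Fin w → Bool))
    (bX : Fin l × Fin a → Bool) (bY : Fin r × Fin b → Bool) (u : Fin l × Fin r → Z)
    [DecidableEq (Fin l × Fin r)]
    (P : Player) (reg : Fin w ↪ Fin S) (ij : Fin l × Fin r) {ρ : Op S} (hρ : ρ.PosSemidef) :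
    ∑ z, ((Gate.output P reg ij : Gate l r a b w S).apply bX bY
      (fun e => enc (Function.update u ij z e)) ρ).trace.re ≤ ρ.trace.re := by
  simp only [trace_output_apply, Function.update_self]
  rw [Finset.sum_comm, trace_re_eq]
  refine Finset.sum_le_sum fun s _ => ?_
  by_cases h : ∃ z, ∀ k, s (reg k) = enc z k
  · obtain ⟨z, hz⟩ := h
    rw [Finset.sum_eq_single z, if_pos hz]
    · intro z' _ hne
      refine if_neg fun hz' => hne (enc.injective (funext fun k => ?_))
      rw [← hz k, hz' k]
    · simp
  · rw [not_exists] at h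
    rw [Finset.sum_eq_zero fun z _ => if_neg (h z)]
    exact re_diag_nonneg hρ s

end GateTrace

/-! ### Runs of a circuit -/

section Runs

variable {l r a b w S : ℕ}

namespace Circuit

lemma run_cons (bX : Fin l × Fin a → Bool) (bY : Fin r × Fin b → Bool)
    (o : Fin l × Fin r → Fin w → Bool) (g : Gate l r a b w S) (c : Circuit l r a b w S)
    (ρ : Op S) : run bX bY o (g :: c) ρ = run bX bY o c (g.apply bX bY o ρ) := rfl

lemma run_append (bX : Fin l × Fin a → Bool) (bY : Fin r × Fin b → Bool)
    (o : Fin l × Fin r → Fin w → Bool) (c c' : Circuit l r a b w S) (ρ : Op S) :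
    run bX bY o (c ++ c') ρ = run bX bY o c' (run bX bY o c ρ) := List.foldl_append

lemma run_add (bX : Fin l × Fin a → Bool) (bY : Fin r × Fin b → Bool)
    (o : Fin l × Fin r → Fin w → Bool) (c : Circuit l r a b w S) (ρ σ : Op S) :
    run bX bY o c (ρ + σ) = run bX bY o c ρ + run bX bY o c σ := by
  induction c generalizing ρ σ with
  | nil => rfl
  | cons g c ih =>
    rw [run_cons, run_cons, run_cons, ← ih]
    exact congrArg _ (krausMap_add _ ρ σ)

lemma run_smul (bX : Fin l × Fin a → Bool) (bY : Fin r × Fin b → Bool)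
    (o : Fin l × Fin r → Fin w → Bool) (c : Circuit l r a b w S) (x : ℂ) (ρ : Op S) :
    run bX bY o c (x • ρ) = x • run bX bY o c ρ := by
  induction c generalizing ρ with
  | nil => rfl
  | cons g c ih =>
    rw [run_cons, run_cons, ← ih]
    exact congrArg _ (krausMap_smul _ x ρ)

lemma run_posSemidef (bX : Fin l × Fin a → Bool) (bY : Fin r × Fin b → Bool)
    (o : Fin l × Fin r → Fin w → Bool) (c : Circuit l r a b w S) {ρ : Op S}
    (hρ : ρ.PosSemidef) : (run bX bY o c ρ).PosSemidef := by
  induction c generalizing ρ with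
  | nil => exact hρ
  | cons g c ih => exact ih (g.apply_posSemidef bX bY o hρ)

/-- The ownership of the cells after a circuit. -/
def finalOwnership (own : Ownership S) (c : Circuit l r a b w S) : Ownership S :=
  c.foldl Gate.next own

lemma valid_append {own : Ownership S} {c c' : Circuit l r a b w S} :
    Valid own (c ++ c') ↔ Valid own c ∧ Valid (finalOwnership own c) c' := by
  induction c generalizing own with
  | nil => simp [Valid, finalOwnership]
  | cons g c ih =>
    rw [List.cons_append, Valid, Valid, ih, and_assoc]
    rfl

lemma trace_run_le {bX : Fin l × Fin a → Bool} {bY : Fin r × Fin b → Bool}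
    {o : Fin l × Fin r → Fin w → Bool} {own : Ownership S} {c : Circuit l r a b w S}
    (hc : Valid own c) {ρ : Op S} (hρ : ρ.PosSemidef) :
    (run bX bY o c ρ).trace.re ≤ ρ.trace.re := by
  induction c generalizing own ρ with
  | nil => exact le_rfl
  | cons g c ih =>
    exact (ih hc.2 (g.apply_posSemidef bX bY o hρ)).trans (Gate.trace_apply_le hc.1 hρ)

lemma outputs_append (c c' : Circuit l r a b w S) :
    outputs (c ++ c') = outputs c ++ outputs c' := List.filterMap_append

lemma comm_append (c c' : Circuit l r a b w S) : comm (c ++ c') = comm c + comm c' := by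
  simp [comm]

lemma comm_cons (g : Gate l r a b w S) (c : Circuit l r a b w S) :
    comm (g :: c) = g.cost + comm c := by
  simp [comm]

lemma outputs_cons_none {g : Gate l r a b w S} (hg : g.label = none) (c : Circuit l r a b w S) :
    outputs (g :: c) = outputs c := List.filterMap_cons_none hg

lemma outputs_cons_some {g : Gate l r a b w S} {ij : Fin l × Fin r} (hg : g.label = some ij)
    (c : Circuit l r a b w S) : outputs (g :: c) = ij :: outputs c :=
  List.filterMap_cons_some hg

lemma run_congr {bX : Fin l × Fin a → Bool} {bY : Fin r × Fin b → Bool}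
    {o o' : Fin l × Fin r → Fin w → Bool} {c : Circuit l r a b w S}
    (h : ∀ ij ∈ outputs c, o ij = o' ij) (ρ : Op S) :
    run bX bY o c ρ = run bX bY o' c ρ := by
  induction c generalizing ρ with
  | nil => rfl
  | cons g c ih =>
    rw [run_cons, run_cons]
    rcases hl : g.label with _ | ij
    · rw [outputs_cons_none hl] at h
      rw [ih h, Gate.apply_congr (o := o) (o' := o') (by simp [hl])]
    · rw [outputs_cons_some hl, List.forall_mem_cons] at h
      rw [ih h.2, Gate.apply_congr (o := o) (o' := o')]
      intro ij' h'
      obtain rfl : ij = ij' := by simpa [hl] using h'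
      exact h.1

lemma length_outputs_mul_le_comm (c : Circuit l r a b w S) :
    (outputs c).length * w ≤ comm c := by
  induction c with
  | nil => simp [outputs]
  | cons g c ih =>
    rw [comm_cons]
    cases g with
    | output P reg ij =>
      rw [outputs_cons_some (ij := ij) rfl, List.length_cons, Gate.cost]
      linarith
    | _ => rw [outputs_cons_none rfl]; omega

end Circuit

end Runs

/-! ### Summing over the values at a list of pairs -/

section AssignSum

variable {ι Z : Type*} [DecidableEq ι] [Fintype Z]

/-- The sum of `F` over all assignments obtained from `u` by changing the values at the indices
in `L`. -/
def assignSum : List ι → ((ι → Z) → ℝ) → (ι → Z) → ℝ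
  | [], F, u => F u
  | i :: L, F, u => ∑ z, assignSum L F (Function.update u i z)

lemma assignSum_mono {L : List ι} {F G : (ι → Z) → ℝ} {u : ι → Z}
    (h : ∀ v, (∀ i, i ∉ L → v i = u i) → F v ≤ G v) : assignSum L F u ≤ assignSum L G u := by
  induction L generalizing u with
  | nil => exact h u fun _ _ => rfl
  | cons i L ih =>
    refine Finset.sum_le_sum fun z _ => ih fun v hv => h v fun j hj => ?_
    rw [List.mem_cons, not_or] at hj
    rw [hv j hj.2, Function.update_of_ne hj.1]

lemma assignSum_const (L : List ι) (C : ℝ) (u : ι → Z) :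
    assignSum L (fun _ => C) u = (Fintype.card Z : ℝ) ^ L.length * C := by
  induction L generalizing u with
  | nil => simp [assignSum]
  | cons i L ih => simp [assignSum, ih, pow_succ]; ring

lemma assignSum_add (L : List ι) (F G : (ι → Z) → ℝ) (u : ι → Z) :
    assignSum L (fun v => F v + G v) u = assignSum L F u + assignSum L G u := by
  induction L generalizing u with
  | nil => rfl
  | cons i L ih => simp only [assignSum, ih, Finset.sum_add_distrib]

lemma assignSum_mul (L : List ι) (C : ℝ) (F : (ι → Z) → ℝ) (u : ι → Z) :
    assignSum L (fun v => C * F v) u = C * assignSum L F u := by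
  induction L generalizing u with
  | nil => rfl
  | cons i L ih => simp only [assignSum, ih, Finset.mul_sum]

lemma assignSum_sum {α : Type*} (L : List ι) (s : Finset α) (F : α → (ι → Z) → ℝ) (u : ι → Z) :
    assignSum L (fun v => ∑ x ∈ s, F x v) u = ∑ x ∈ s, assignSum L (F x) u := by
  induction L generalizing u with
  | nil => rfl
  | cons i L ih => simp only [assignSum, ih]; exact Finset.sum_comm

lemma le_assignSum {L : List ι} {F : (ι → Z) → ℝ} (hF : ∀ v, 0 ≤ F v) {u v : ι → Z}
    (hv : ∀ i, i ∉ L → v i = u i) : F v ≤ assignSum L F u := by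
  induction L generalizing u with
  | nil => rw [show v = u from funext fun i => hv i (by simp)]; exact le_rfl
  | cons i L ih =>
    have hnn : ∀ (L : List ι) (u : ι → Z), 0 ≤ assignSum L F u := by
      intro L u
      have := assignSum_mono (L := L) (F := fun _ => 0) (G := F) (u := u) fun v _ => hF v
      rwa [assignSum_const, mul_zero] at this
    refine (ih (u := Function.update u i (v i)) fun j hj => ?_).trans
      (Finset.single_le_sum (f := fun z => assignSum L F (Function.update u i z))
        (fun z _ => hnn L _) (Finset.mem_univ (v i)))
    by_cases h : j = i
    · rw [h, Function.update_self]
    · rw [Function.update_of_ne h]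
      exact hv j (by simp [h, hj])

end AssignSum

/-- The probabilities of the possible outputs of a circuit add up to at most one. -/
lemma assignSum_trace_run_le {Z : Type*} [Fintype Z] {l r a b w S : ℕ} (enc : Z ↪ (Fin w → Bool))
    (bX : Fin l × Fin a → Bool) (bY : Fin r × Fin b → Bool) {own : Ownership S}
    {c : Circuit l r a b w S} (hc : c.Valid own) (hn : c.outputs.Nodup) {ρ : Op S}
    (hρ : ρ.PosSemidef) (u : Fin l × Fin r → Z) :
    assignSum c.outputs (fun v => (c.run bX bY (fun e => enc (v e)) ρ).trace.re) u ≤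
      ρ.trace.re := by
  induction c generalizing own ρ u with
  | nil => exact le_rfl
  | cons g c ih =>
    rcases hl : g.label with _ | ij
    · rw [Circuit.outputs_cons_none hl] at hn ⊢
      refine le_trans (assignSum_mono fun v _ => le_of_eq ?_)
        ((ih hc.2 hn (g.apply_posSemidef bX bY (fun e => enc (u e)) hρ) u).trans
          (Gate.trace_apply_le hc.1 hρ))
      rw [Circuit.run_cons, Gate.apply_congr (o' := fun e => enc (u e)) (by simp [hl])]
    · cases g with
      | output P reg ij =>
        rw [Circuit.outputs_cons_some (ij := ij) rfl] at hn ⊢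
        rw [List.nodup_cons] at hn
        refine le_trans (Finset.sum_le_sum fun z _ => ?_)
          (sum_trace_output_apply_le enc bX bY u P reg ij hρ)
        refine le_trans (assignSum_mono fun v hv => le_of_eq ?_) (ih hc.2 hn.2
          (Gate.apply_posSemidef bX bY (fun e => enc (Function.update u ij z e)) _ hρ) _)
        rw [Circuit.run_cons, Gate.apply_congr (o' := fun e => enc (Function.update u ij z e))]
        intro ij' h'
        obtain rfl : ij = ij' := by simpa [Gate.label] using h'
        rw [hv ij hn.1]
      | _ => simp [Gate.label] at hl

/-! ### Communication bounds the dependence on both inputs -/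

section ProductStates

variable {l r a b w S : ℕ} {𝒳 𝒴 : Type*}

/-- The state is a product of a state of Alice's cells, depending on Alice's input only, and a state
of Bob's cells, depending on Bob's input only; `H` assigns every cell to a player. The padding with
all-ones matrices in `LocalState` accounts for the factor `2 ^ S`. -/
def ProductState (H : Fin S → Player) (ρ : 𝒳 → 𝒴 → Op S) : Prop :=
  ∃ (A : 𝒳 → Op S) (B : 𝒴 → Op S), (∀ x, LocalState {q | H q = .alice} (A x)) ∧
    (∀ y, LocalState {q | H q = .alice}ᶜ (B y)) ∧ ∀ x y, ρ x y = (2 : ℂ) ^ S • (A x ⊙ B y)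

/-- `H` extends the ownership `own` to the cells that are not in use. -/
def Extends (own : Ownership S) (H : Fin S → Player) : Prop :=
  ∀ q P, own q = some P → H q = P

lemma Player.ne_alice_iff {P : Player} : P ≠ .alice ↔ P = .bob := by
  cases P <;> simp

lemma setOf_update_bob (H : Fin S → Player) (q : Fin S) :
    {q' | Function.update H q .bob q' = .alice} = {q' | H q' = .alice} \ {q} := by
  ext q'
  by_cases h : q' = q
  · subst h; simp
  · simp [h]

lemma setOf_update_alice (H : Fin S → Player) (q : Fin S) :
    {q' | Function.update H q .alice q' = .alice} = insert q {q' | H q' = .alice} := by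
  ext q'
  by_cases h : q' = q
  · subst h; simp
  · simp [h]

lemma compl_diff_singleton' (L : Set (Fin S)) (q : Fin S) : (L \ {q})ᶜ = insert q Lᶜ := by
  ext q'; by_cases h : q' = q <;> simp [h]

lemma compl_insert' (L : Set (Fin S)) (q : Fin S) : (insert q L)ᶜ = Lᶜ \ {q} := by
  ext q'; simp [and_comm]

/-- The coefficients `1, 1, 1, 1, -4, -4` have absolute values adding up to `12 ≤ 16`. -/
lemma abs_le_of_transfer_decomposition {V : Type*} [AddCommGroup V] [Module ℝ V] {Ψ : V → ℝ}
    (hΨ : IsLinearMap ℝ Ψ) {β : ℝ} {ρ τ₁ τ₂ τ₃ τ₄ τ₅ τ₆ : V}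
    (h : ρ = τ₁ + τ₂ + τ₃ + τ₄ - (4 : ℝ) • τ₅ - (4 : ℝ) • τ₆) (h₁ : |Ψ τ₁| ≤ β)
    (h₂ : |Ψ τ₂| ≤ β) (h₃ : |Ψ τ₃| ≤ β) (h₄ : |Ψ τ₄| ≤ β) (h₅ : |Ψ τ₅| ≤ β)
    (h₆ : |Ψ τ₆| ≤ β) : |Ψ ρ| ≤ 16 * β := by
  rw [h, hΨ.map_sub, hΨ.map_sub, hΨ.map_add, hΨ.map_add, hΨ.map_add, hΨ.map_smul, hΨ.map_smul,
    smul_eq_mul, smul_eq_mul]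
  rw [abs_le] at *
  constructor <;> linarith [h₁.1, h₁.2]

/-- Moving one cell to another player costs a constant factor. -/
lemma abs_le_of_update {Ψ : (𝒳 → 𝒴 → Op S) → ℝ} (hΨ : IsLinearMap ℝ Ψ) {β : ℝ}
    {H : Fin S → Player} {q : Fin S} {P : Player}
    (h : ∀ ρ, ProductState (Function.update H q P) ρ → |Ψ ρ| ≤ β) (ρ : 𝒳 → 𝒴 → Op S)
    (hρ : ProductState H ρ) : |Ψ ρ| ≤ 16 * β := by
  by_cases hP : H q = P
  · rw [← hP, Function.update_eq_self] at h
    have := h ρ hρ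
    linarith [abs_nonneg (Ψ ρ)]
  obtain ⟨A, B, hA, hB, hAB⟩ := hρ
  have n1 : ‖(1 : ℂ)‖ = 1 := by simp
  have n2 : ‖(-1 : ℂ)‖ = 1 := by simp
  have n3 : ‖-Complex.I‖ = 1 := by simp
  have n4 : ‖Complex.I‖ = 1 := by simp
  cases P with
  | bob =>
    have key : ∀ v w : Bool → ℂ, (∀ e, ‖v e‖ ≤ 1) → (∀ e, ‖w e‖ ≤ 1) →
        |Ψ fun x y => (2 : ℂ) ^ S • transferTerm q v w (A x) (B y)| ≤ β := by
      intro v w hv hw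
      refine h _ ⟨fun x => giveCell q v (A x), fun y => cellDiag q w * B y * (cellDiag q w)ᴴ,
        fun x => ?_, fun y => ?_, fun x y => rfl⟩
      · rw [setOf_update_bob]; exact (hA x).giveCell hv
      · rw [setOf_update_bob, compl_diff_singleton']; exact (hB y).takeCell hw
    refine abs_le_of_transfer_decomposition hΨ ?_
      (key _ _ (norm_phaseVec_le n1) (norm_phaseVec_le n1))
      (key _ _ (norm_phaseVec_le n2) (norm_phaseVec_le n2))
      (key _ _ (norm_phaseVec_le n3) (norm_phaseVec_le n4))
      (key _ _ (norm_phaseVec_le n4) (norm_phaseVec_le n3))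
      (key _ _ (norm_unitVec_le false) (norm_unitVec_le true))
      (key _ _ (norm_unitVec_le true) (norm_unitVec_le false))
    funext x y
    rw [hAB, transfer_decomposition q (A x) (B y)]
    ext s t
    simp
    ring
  | alice =>
    have key : ∀ v w : Bool → ℂ, (∀ e, ‖v e‖ ≤ 1) → (∀ e, ‖w e‖ ≤ 1) →
        |Ψ fun x y => (2 : ℂ) ^ S • transferTerm q v w (B y) (A x)| ≤ β := by
      intro v w hv hw
      refine h _ ⟨fun x => cellDiag q w * A x * (cellDiag q w)ᴴ, fun y => giveCell q v (B y),
        fun x => ?_, fun y => ?_, fun x y => ?_⟩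
      · rw [setOf_update_alice]; exact (hA x).takeCell hw
      · rw [setOf_update_alice, compl_insert']; exact (hB y).giveCell hv
      · exact congrArg _ (hadamard_comm _ _)
    refine abs_le_of_transfer_decomposition hΨ ?_
      (key _ _ (norm_phaseVec_le n1) (norm_phaseVec_le n1))
      (key _ _ (norm_phaseVec_le n2) (norm_phaseVec_le n2))
      (key _ _ (norm_phaseVec_le n3) (norm_phaseVec_le n4))
      (key _ _ (norm_phaseVec_le n4) (norm_phaseVec_le n3))
      (key _ _ (norm_unitVec_le false) (norm_unitVec_le true))
      (key _ _ (norm_unitVec_le true) (norm_unitVec_le false))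
    funext x y
    rw [hAB, hadamard_comm, transfer_decomposition q (B y) (A x)]
    ext s t
    simp
    ring

lemma abs_le_of_piecewise {Ψ : (𝒳 → 𝒴 → Op S) → ℝ} (hΨ : IsLinearMap ℝ Ψ) {β : ℝ}
    {H : Fin S → Player} {P : Player} (T : Finset (Fin S))
    (h : ∀ ρ, ProductState (fun q => if q ∈ T then P else H q) ρ → |Ψ ρ| ≤ β)
    (ρ : 𝒳 → 𝒴 → Op S) (hρ : ProductState H ρ) : |Ψ ρ| ≤ 16 ^ T.card * β := by
  induction T using Finset.induction_on generalizing β with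
  | empty => simpa using h ρ (by simpa using hρ)
  | insert q T hq ih =>
    rw [Finset.card_insert_of_notMem hq, pow_succ, mul_assoc]
    refine ih (abs_le_of_update (q := q) (P := P) hΨ fun σ hσ => h σ ?_)
    convert hσ using 1
    funext q'
    by_cases hq' : q' = q
    · subst hq'; simp
    · simp [hq']

namespace Gate

/-- The player who performs a gate. A fresh qubit is prepared by the player to whom `H` assigns the
unused cell. -/
def actor (H : Fin S → Player) : Gate l r a b w S → Player
  | unitary P _ _ => P
  | queryA _ _ _ => .alice
  | queryB _ _ _ => .bob
  | measure P _ => P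
  | fresh _ q => H q
  | discard P _ => P
  | send P _ => P
  | output P _ _ => P

/-- The assignment of the cells to the players after a gate. -/
def nextAssign (H : Fin S → Player) : Gate l r a b w S → (Fin S → Player)
  | fresh P q => Function.update H q P
  | send P q => Function.update H q P.other
  | output P reg _ => fun q => if q ∈ Finset.univ.map reg then P.other else H q
  | _ => H

lemma extends_next {own : Ownership S} {H : Fin S → Player} (h : Extends own H)
    (g : Gate l r a b w S) : Extends (g.next own) (g.nextAssign H) := by
  intro q' P' hq'
  cases g with
  | unitary P T U => exact h q' P' hq'
  | queryA T addr q => exact h q' P' hq'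
  | queryB T addr q => exact h q' P' hq'
  | measure P q => exact h q' P' hq'
  | fresh P q =>
    by_cases hqq : q' = q
    · subst hqq; simpa [next, nextAssign] using hq'
    · simp only [next, nextAssign, Function.update_of_ne hqq] at hq' ⊢
      exact h q' P' hq'
  | discard P q =>
    by_cases hqq : q' = q
    · subst hqq; simp [next] at hq'
    · simp only [next, nextAssign, Function.update_of_ne hqq] at hq' ⊢
      exact h q' P' hq'
  | send P q =>
    by_cases hqq : q' = q
    · subst hqq; simpa [next, nextAssign] using hq'
    · simp only [next, nextAssign, Function.update_of_ne hqq] at hq' ⊢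
      exact h q' P' hq'
  | output P reg ij =>
    by_cases hqq : ∃ k, reg k = q'
    · simpa [next, nextAssign, hqq] using hq'
    · simp only [next, nextAssign, if_neg hqq, Finset.mem_map, Finset.mem_univ, true_and]
        at hq' ⊢
      exact h q' P' hq'

/-- The Kraus operators of an allowed gate act on the cells of its actor. -/
lemma kraus_local {bX : Fin l × Fin a → Bool} {bY : Fin r × Fin b → Bool}
    {o : Fin l × Fin r → Fin w → Bool} {own : Ownership S} {H : Fin S → Player}
    {g : Gate l r a b w S} (hg : g.Allowed own) (hH : Extends own H) :
    ∀ K ∈ g.kraus bX bY o, LocalOp {q | H q = g.actor H} K := by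
  cases g with
  | unitary P T U =>
    simp only [kraus, List.forall_mem_singleton]
    exact localOp_liftOp (fun q hq => hH q P (hg q hq)) _
  | queryA T addr q =>
    simp only [kraus, List.forall_mem_singleton]
    exact localOp_queryOp _ (fun q hq => hH q _ (hg.1 q hq)) _ (hH q _ hg.2.1)
  | queryB T addr q =>
    simp only [kraus, List.forall_mem_singleton]
    exact localOp_queryOp _ (fun q hq => hH q _ (hg.1 q hq)) _ (hH q _ hg.2.1)
  | measure P q =>
    have hq := hH q P hg
    intro K hK
    simp only [kraus, List.mem_cons, List.not_mem_nil, or_false] at hK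
    rcases hK with rfl | rfl <;>
    exact localOp_basisProj fun m s hm => by simp [flipBy, hm q hq]
  | fresh P q =>
    intro K hK
    simp only [kraus, List.mem_cons, List.not_mem_nil, or_false] at hK
    rcases hK with rfl | rfl <;>
    exact (localOp_update (L := {q' | H q' = H q}) (q := q) rfl (fun _ => false) fun _ _ _ => rfl).mul
      (localOp_basisProj fun m s hm => by simp [flipBy, hm q rfl])
  | discard P q =>
    simp only [kraus, List.forall_mem_singleton]
    exact localOp_one _
  | send P q =>
    simp only [kraus, List.forall_mem_singleton]
    exact localOp_one _
  | output P reg ij =>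
    simp only [kraus, List.forall_mem_singleton]
    exact localOp_basisProj fun m s hm =>
      forall_congr' fun k => by simp [flipBy, hm (reg k) (hH _ _ (hg k))]

lemma kraus_eq_of_actor_alice {bX : Fin l × Fin a → Bool} (bY bY' : Fin r × Fin b → Bool)
    {o : Fin l × Fin r → Fin w → Bool} {H : Fin S → Player} {g : Gate l r a b w S}
    (h : g.actor H = .alice) : g.kraus bX bY o = g.kraus bX bY' o := by
  cases g with
  | queryB T addr q => simp [actor] at h
  | _ => rfl

lemma kraus_eq_of_actor_bob (bX bX' : Fin l × Fin a → Bool) {bY : Fin r × Fin b → Bool}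
    {o : Fin l × Fin r → Fin w → Bool} {H : Fin S → Player} {g : Gate l r a b w S}
    (h : g.actor H = .bob) : g.kraus bX bY o = g.kraus bX' bY o := by
  cases g with
  | queryA T addr q => simp [actor] at h
  | _ => rfl

lemma localState_apply {bX : Fin l × Fin a → Bool} {bY : Fin r × Fin b → Bool}
    {o : Fin l × Fin r → Fin w → Bool} {own : Ownership S} {H : Fin S → Player}
    {g : Gate l r a b w S} (hg : g.Allowed own) (hH : Extends own H) {A : Op S}
    (hA : LocalState {q | H q = g.actor H} A) :
    LocalState {q | H q = g.actor H} (g.apply bX bY o A) where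
  psd := g.apply_posSemidef bX bY o hA.psd
  trace_le := (trace_apply_le hg hA.psd).trans hA.trace_le
  dep := krausMap_dependsOn _ (kraus_local hg hH) hA.dep

end Gate

lemma setOf_bob_eq (H : Fin S → Player) : {q | H q = .bob} = {q | H q = .alice}ᶜ := by
  ext q; simp [Player.ne_alice_iff]

/-- A gate acts on one factor of a product state. -/
lemma ProductState.apply_eq (bX : 𝒳 → Fin l × Fin a → Bool) (bY : 𝒴 → Fin r × Fin b → Bool)
    (o : Fin l × Fin r → Fin w → Bool) {own : Ownership S} {H : Fin S → Player}
    {g : Gate l r a b w S} (hg : g.Allowed own) (hH : Extends own H)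
    {A : 𝒳 → Op S} {B : 𝒴 → Op S} (hA : ∀ x, LocalState {q | H q = .alice} (A x))
    (hB : ∀ y, LocalState {q | H q = .alice}ᶜ (B y)) (x : 𝒳) (y : 𝒴) :
    (g.actor H = .alice → g.apply (bX x) (bY y) o ((2 : ℂ) ^ S • (A x ⊙ B y)) =
      (2 : ℂ) ^ S • (g.apply (bX x) (fun _ => false) o (A x) ⊙ B y)) ∧
    (g.actor H = .bob → g.apply (bX x) (bY y) o ((2 : ℂ) ^ S • (A x ⊙ B y)) =
      (2 : ℂ) ^ S • (A x ⊙ g.apply (fun _ => false) (bY y) o (B y))) := by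
  constructor
  · intro h
    change krausMap _ _ = _ • (krausMap _ _ ⊙ _)
    rw [krausMap_smul, Gate.kraus_eq_of_actor_alice (bY y) (fun _ => false) h,
      krausMap_hadamard _ (L := {q | H q = .alice}) (h ▸ Gate.kraus_local hg hH) (hB y).dep
        (hB y).psd.1]
  · intro h
    change krausMap _ _ = _ • (_ ⊙ krausMap _ _)
    rw [krausMap_smul, Gate.kraus_eq_of_actor_bob (bX x) (fun _ => false) h, hadamard_comm,
      krausMap_hadamard _ (L := {q | H q = .bob}) (h ▸ Gate.kraus_local hg hH)
        (by rw [setOf_bob_eq, compl_compl]; exact (hA x).dep) (hA x).psd.1, hadamard_comm]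

lemma ProductState.apply (bX : 𝒳 → Fin l × Fin a → Bool) (bY : 𝒴 → Fin r × Fin b → Bool)
    (o : Fin l × Fin r → Fin w → Bool) {own : Ownership S} {H : Fin S → Player}
    {g : Gate l r a b w S} (hg : g.Allowed own) (hH : Extends own H) {ρ : 𝒳 → 𝒴 → Op S}
    (hρ : ProductState H ρ) :
    ProductState H fun x y => g.apply (bX x) (bY y) o (ρ x y) := by
  obtain ⟨A, B, hA, hB, hAB⟩ := hρ
  simp only [hAB]
  have key := ProductState.apply_eq bX bY o hg hH hA hB
  rcases hact : g.actor H with _ | _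
  · exact ⟨fun x => g.apply (bX x) (fun _ => false) o (A x), B,
      fun x => hact ▸ Gate.localState_apply hg hH (hact ▸ hA x), hB,
      fun x y => (key x y).1 hact⟩
  · rw [← setOf_bob_eq] at hB
    refine ⟨A, fun y => g.apply (fun _ => false) (bY y) o (B y), hA, fun y => ?_,
      fun x y => (key x y).2 hact⟩
    rw [← setOf_bob_eq]
    exact hact ▸ Gate.localState_apply hg hH (hact ▸ hB y)

/-- If all Kraus operators leave the cell `q` in state `|0⟩`, so does the map. -/
lemma krausMap_apply_ne_zero {q : Fin S} (Ks : List (Op S))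
    (hK : ∀ K ∈ Ks, ∀ s t, K s t ≠ 0 → s q = false) (ρ : Op S) (s t : Basis S)
    (h : krausMap Ks ρ s t ≠ 0) : s q = false ∧ t q = false := by
  induction Ks with
  | nil => simp at h
  | cons K Ks ih =>
    rw [List.forall_mem_cons] at hK
    by_contra hst
    refine h ?_
    rw [krausMap_cons, Matrix.add_apply, not_imp_comm.1 (ih hK.2) hst, add_zero, conj_apply]
    rcases not_and_or.1 hst with h' | h'
    · simp [not_imp_comm.1 (hK.1 s _) h']
    · simp [not_imp_comm.1 (hK.1 t _) h']

lemma Gate.fresh_apply_ne_zero (bX : Fin l × Fin a → Bool) (bY : Fin r × Fin b → Bool)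
    (o : Fin l × Fin r → Fin w → Bool) (P : Player) (q : Fin S) (A : Op S) (s t : Basis S)
    (h : (Gate.fresh P q : Gate l r a b w S).apply bX bY o A s t ≠ 0) :
    s q = false ∧ t q = false := by
  refine krausMap_apply_ne_zero _ (fun K hK s t hst => ?_) A s t h
  simp only [Gate.kraus, List.mem_cons, List.not_mem_nil, or_false] at hK
  have : ∀ p : Basis S → Prop, ∀ [DecidablePred p],
      (basisMap (fun s => Function.update s q false) * basisProj p) s t ≠ 0 → s q = false := by
    intro p _ h
    rw [basisProj, mul_diagonal] at h
    have h1 : s = Function.update t q false := by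
      by_contra hne
      exact left_ne_zero_of_mul h (by simp [basisMap, hne])
    rw [h1, Function.update_self]
  rcases hK with rfl | rfl
  · exact this _ hst
  · exact this _ hst

/-- A fresh qubit does not cost anything, even if its cell was assigned to the other player. -/
lemma ProductState.apply_fresh (bX : 𝒳 → Fin l × Fin a → Bool) (bY : 𝒴 → Fin r × Fin b → Bool)
    (o : Fin l × Fin r → Fin w → Bool) {own : Ownership S} {H : Fin S → Player} {P : Player}
    {q : Fin S} (hg : (Gate.fresh P q : Gate l r a b w S).Allowed own) (hH : Extends own H)
    {ρ : 𝒳 → 𝒴 → Op S} (hρ : ProductState H ρ) :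
    ProductState (Function.update H q P) fun x y =>
      (Gate.fresh P q : Gate l r a b w S).apply (bX x) (bY y) o (ρ x y) := by
  by_cases hP : H q = P
  · rw [← hP, Function.update_eq_self]
    exact hρ.apply bX bY o hg hH
  set g : Gate l r a b w S := Gate.fresh P q with hgdef
  obtain ⟨A, B, hA, hB, hAB⟩ := hρ
  simp only [hAB]
  have key := ProductState.apply_eq bX bY o hg hH hA hB
  cases P with
  | bob =>
    have hq : H q = .alice := by cases h : H q <;> simp [h] at hP ⊢
    have hact : g.actor H = .alice := hq
    have hz := fun x => Gate.fresh_apply_ne_zero (bX x)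
      (fun _ => false : Fin r × Fin b → Bool) o .bob q (A x)
    refine ⟨fun x => giveZeroCell q (g.apply (bX x) (fun _ => false) o (A x)),
      fun y => takeZeroCell q (B y), fun x => ?_, fun y => ?_, fun x y => ?_⟩
    · rw [setOf_update_bob]
      exact LocalState.giveZeroCell (hact ▸ Gate.localState_apply hg hH (hact ▸ hA x)) (hz x)
    · rw [setOf_update_bob, compl_diff_singleton']
      exact (hB y).takeZeroCell (by simp [hq])
    · exact ((key x y).1 hact).trans (congrArg _ (hadamard_eq_zeroCell _ (hz x)))
  | alice =>
    have hq : H q = .bob := by cases h : H q <;> simp [h] at hP ⊢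
    have hact : g.actor H = .bob := hq
    have hz := fun y => Gate.fresh_apply_ne_zero
      (fun _ => false : Fin l × Fin a → Bool) (bY y) o .alice q (B y)
    refine ⟨fun x => takeZeroCell q (A x),
      fun y => giveZeroCell q (g.apply (fun _ => false) (bY y) o (B y)), fun x => ?_,
      fun y => ?_, fun x y => ?_⟩
    · rw [setOf_update_alice]
      exact (hA x).takeZeroCell (by simp [hq])
    · rw [setOf_update_alice, compl_insert']
      refine LocalState.giveZeroCell ?_ (hz y)
      have hB' := hB y
      rw [← setOf_bob_eq] at hB' ⊢
      exact hact ▸ Gate.localState_apply hg hH (hact ▸ hB')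
    · refine ((key x y).2 hact).trans (congrArg _ ?_)
      rw [hadamard_comm, hadamard_eq_zeroCell _ (hz y)]
      exact hadamard_comm _ _

variable [Fintype 𝒳] [Fintype 𝒴]

lemma isLinearMap_sum_trace_run (bX : 𝒳 → Fin l × Fin a → Bool)
    (bY : 𝒴 → Fin r × Fin b → Bool) (o : Fin l × Fin r → Fin w → Bool) (W : 𝒳 → 𝒴 → ℝ)
    (c : Circuit l r a b w S) : IsLinearMap ℝ fun ρ : 𝒳 → 𝒴 → Op S =>
      ∑ x, ∑ y, W x y * (c.run (bX x) (bY y) o (ρ x y)).trace.re := by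
  constructor
  · intro ρ σ
    simp only [Pi.add_apply, Circuit.run_add, trace_add, Complex.add_re, mul_add,
      Finset.sum_add_distrib]
  · intro t ρ
    have h : ∀ x y, (t • ρ) x y = (t : ℂ) • ρ x y := fun x y => rfl
    simp only [h, Circuit.run_smul, trace_smul, smul_eq_mul, Complex.re_ofReal_mul, Finset.mul_sum]
    exact Finset.sum_congr rfl fun x _ => Finset.sum_congr rfl fun y _ => by ring

/-- If a weight `W` has correlation at most `β` with products `a x * b y`, then it has correlation
at most `16 ^ n * β` with the probabilities of a fixed output of a circuit with communication `n`. -/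
theorem abs_sum_trace_run_le (bX : 𝒳 → Fin l × Fin a → Bool) (bY : 𝒴 → Fin r × Fin b → Bool)
    (o : Fin l × Fin r → Fin w → Bool) (W : 𝒳 → 𝒴 → ℝ) (β : ℝ)
    (hW : ∀ (α : 𝒳 → ℝ) (γ : 𝒴 → ℝ), (∀ x, 0 ≤ α x ∧ α x ≤ 1) → (∀ y, 0 ≤ γ y ∧ γ y ≤ 1) →
      |∑ x, ∑ y, W x y * (α x * γ y)| ≤ β)
    (c : Circuit l r a b w S) (own : Ownership S) (hc : c.Valid own) (H : Fin S → Player)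
    (hH : Extends own H) (ρ : 𝒳 → 𝒴 → Op S) (hρ : ProductState H ρ) :
    |∑ x, ∑ y, W x y * (c.run (bX x) (bY y) o (ρ x y)).trace.re| ≤ 16 ^ c.comm * β := by
  induction c generalizing own H ρ with
  | nil =>
    obtain ⟨A, B, hA, hB, hAB⟩ := hρ
    have h : ∀ x y, (Circuit.run (bX x) (bY y) o ([] : Circuit l r a b w S) (ρ x y)).trace.re =
        (A x).trace.re * (B y).trace.re := fun x y => by
      rw [← hadamard_trace_re (hA x) (hB y), ← hAB]; rfl
    simp only [h, Circuit.comm, List.map_nil, List.sum_nil, pow_zero, one_mul]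
    exact hW _ _ (fun x => ⟨trace_re_nonneg (hA x).psd, (hA x).trace_le⟩)
      (fun y => ⟨trace_re_nonneg (hB y).psd, (hB y).trace_le⟩)
  | cons g c ih =>
    have ih' := ih _ hc.2 _ (g.extends_next hH)
    have hlin := isLinearMap_sum_trace_run bX bY o W c
    have hρ' := hρ.apply bX bY o hc.1 hH
    simp only [Circuit.run_cons, Circuit.comm_cons, pow_add]
    cases g with
    | fresh P q =>
      have := ih' _ (hρ.apply_fresh bX bY o hc.1 hH)
      simpa [Gate.cost] using this
    | send P q =>
      rw [mul_assoc]
      exact (abs_le_of_update hlin ih' _ hρ').trans_eq (by simp [Gate.cost])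
    | output P reg ij =>
      rw [mul_assoc]
      exact (abs_le_of_piecewise hlin _ ih' _ hρ').trans_eq (by simp [Gate.cost])
    | _ =>
      have := ih' _ hρ'
      simpa [Gate.cost] using this

end ProductStates

/-! ### The success probability of a short segment of a protocol -/

section Segments

variable {S : ℕ}

/-- The state `|s⟩⟨s|`. -/
def basisState (s : Basis S) : Op S := basisProj fun t => t = s

lemma basisState_posSemidef (s : Basis S) : (basisState s).PosSemidef := by
  rw [basisState, basisProj]
  refine PosSemidef.diagonal fun t => ?_
  by_cases h : t = s <;> simp [h]

lemma trace_basisState (s : Basis S) : (basisState s).trace = 1 := by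
  simp [basisState, basisProj, trace_diagonal]

lemma sum_basisState : ∑ s : Basis S, basisState s = 1 := by
  ext t t'
  rw [Matrix.sum_apply]
  by_cases h : t = t'
  · subst h; simp [basisState, basisProj]
  · simp [basisState, basisProj, h]

/-- The restriction of `|s⟩⟨s|` to the cells in `L`, padded with the all-ones matrix. -/
def restrictedState (L : Set (Fin S)) (s : Basis S) : Op S :=
  open Classical in
  vecMulVec (fun t => if ∀ q ∈ L, t q = s q then 1 else 0)
    (star fun t => if ∀ q ∈ L, t q = s q then 1 else 0)

lemma restrictedState_apply (L : Set (Fin S)) (s t t' : Basis S) [Decidable (∀ q ∈ L, t q = s q)]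
    [Decidable (∀ q ∈ L, t' q = s q)] : restrictedState L s t t' =
      (if ∀ q ∈ L, t q = s q then 1 else 0) * (if ∀ q ∈ L, t' q = s q then 1 else 0) := by
  simp only [restrictedState, vecMulVec_apply, Pi.star_apply]
  congr 1
  · congr
  · split_ifs <;> simp

lemma restrictedState_posSemidef (L : Set (Fin S)) (s : Basis S) :
    (restrictedState L s).PosSemidef := posSemidef_vecMulVec_self_star _

lemma restrictedState_dependsOn (L : Set (Fin S)) (s : Basis S) :
    DependsOn L (restrictedState L s) := by
  classical
  intro t t' u ht
  have h : (∀ q ∈ L, t q = s q) ↔ ∀ q ∈ L, t' q = s q :=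
    forall₂_congr fun q hq => by rw [ht q hq]
  rw [restrictedState_apply, restrictedState_apply]
  simp only [h]

lemma trace_restrictedState_pos (L : Set (Fin S)) (s : Basis S) :
    0 < (restrictedState L s).trace.re := by
  classical
  rw [trace_re_eq]
  refine Finset.sum_pos' (fun t _ => re_diag_nonneg (restrictedState_posSemidef L s) t)
    ⟨s, Finset.mem_univ s, ?_⟩
  rw [restrictedState_apply]
  simp

lemma restrictedState_hadamard_compl (L : Set (Fin S)) (s : Basis S) :
    restrictedState L s ⊙ restrictedState Lᶜ s = basisState s := by
  classical
  ext t t'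
  have h : ∀ t : Basis S, t = s ↔ (∀ q ∈ L, t q = s q) ∧ ∀ q ∈ Lᶜ, t q = s q := by
    intro t
    refine ⟨fun h => by simp [h], fun h => funext fun q => ?_⟩
    by_cases hq : q ∈ L
    · exact h.1 q hq
    · exact h.2 q hq
  have hite : ∀ t : Basis S, (if ∀ q ∈ L, t q = s q then (1 : ℂ) else 0) *
      (if ∀ q ∈ Lᶜ, t q = s q then 1 else 0) = if t = s then 1 else 0 := by
    intro t
    rw [ite_zero_mul_ite_zero, one_mul]
    exact if_congr (h t).symm rfl rfl
  rw [hadamard_apply, restrictedState_apply, restrictedState_apply, basisState, basisProj,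
    diagonal_apply, mul_mul_mul_comm, hite, hite]
  by_cases h1 : t = s
  · subst h1
    simp [eq_comm]
  · simp [h1]

lemma localState_restrictedState (L : Set (Fin S)) (s : Basis S) :
    LocalState L ((((restrictedState L s).trace.re)⁻¹ : ℝ) • restrictedState L s) where
  psd := (restrictedState_posSemidef L s).smul (inv_nonneg.2 (trace_restrictedState_pos L s).le)
  trace_le := by
    rw [trace_smul, Complex.smul_re, smul_eq_mul,
      inv_mul_cancel₀ (trace_restrictedState_pos L s).ne']
  dep := by
    intro t t' u ht
    rw [Matrix.smul_apply, Matrix.smul_apply, restrictedState_dependsOn L s t t' u ht]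

lemma productState_basisState {𝒳 𝒴 : Type*} (H : Fin S → Player) (s : Basis S) :
    ProductState H fun (_ : 𝒳) (_ : 𝒴) => basisState s := by
  set L : Set (Fin S) := {q | H q = .alice}
  refine ⟨fun _ => _, fun _ => _, fun _ => localState_restrictedState L s,
    fun _ => localState_restrictedState Lᶜ s, fun _ _ => ?_⟩
  have h := two_pow_mul_trace_hadamard (restrictedState_dependsOn L s)
    (restrictedState_posSemidef L s).1 (restrictedState_dependsOn Lᶜ s)
    (restrictedState_posSemidef Lᶜ s).1
  have h1 := trace_restrictedState_pos L s
  have h2 := trace_restrictedState_pos Lᶜ s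
  rw [restrictedState_hadamard_compl, trace_basisState, mul_one,
    trace_eq_re (restrictedState_posSemidef L s),
    trace_eq_re (restrictedState_posSemidef Lᶜ s)] at h
  rw [smul_hadamard, hadamard_smul, restrictedState_hadamard_compl, h]
  ext t t'
  have e1 : ((restrictedState L s).trace.re : ℂ) ≠ 0 := by exact_mod_cast h1.ne'
  have e2 : ((restrictedState Lᶜ s).trace.re : ℂ) ≠ 0 := by exact_mod_cast h2.ne'
  simp only [Matrix.smul_apply, smul_eq_mul, Complex.real_smul]
  push_cast
  field_simp

/-- A state of trace at most one is dominated by the identity. -/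
lemma posSemidef_one_sub {ρ : Op S} (hρ : ρ.PosSemidef) (htr : ρ.trace.re ≤ 1) :
    (1 - ρ).PosSemidef := by
  set U : Op S := (hρ.1.eigenvectorUnitary).1 with hU
  set D : Op S := diagonal fun s => (hρ.1.eigenvalues s : ℂ) with hD
  have h1 : ρ = U * D * Uᴴ := hρ.1.spectral_theorem
  have h2 : U * Uᴴ = 1 := Matrix.mem_unitaryGroup_iff.1 hρ.1.eigenvectorUnitary.2
  have h3 : 1 - ρ = U * (1 - D) * Uᴴ := by
    rw [mul_sub, sub_mul, mul_one, h2, ← h1]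
  rw [h3]
  refine PosSemidef.mul_mul_conjTranspose_same ?_ U
  rw [hD, ← diagonal_one, diagonal_sub]
  refine PosSemidef.diagonal fun s => ?_
  have h4 : hρ.1.eigenvalues s ≤ 1 := by
    refine le_trans ?_ htr
    have : ρ.trace.re = ∑ s, hρ.1.eigenvalues s := by
      rw [hρ.1.trace_eq_sum_eigenvalues]; simp
    rw [this]
    exact Finset.single_le_sum (fun s _ => hρ.eigenvalues_nonneg s) (Finset.mem_univ s)
  have : (0 : ℂ) ≤ ((1 - hρ.1.eigenvalues s : ℝ) : ℂ) := by
    exact_mod_cast sub_nonneg.2 h4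
  simpa using this

variable {l r a b w : ℕ}

lemma Circuit.run_sum {ι : Type*} (bX : Fin l × Fin a → Bool) (bY : Fin r × Fin b → Bool)
    (o : Fin l × Fin r → Fin w → Bool) (c : Circuit l r a b w S) (I : Finset ι) (ρ : ι → Op S) :
    c.run bX bY o (∑ i ∈ I, ρ i) = ∑ i ∈ I, c.run bX bY o (ρ i) := by
  classical
  induction I using Finset.induction_on with
  | empty => simpa using c.run_smul bX bY o 0 0
  | insert i I hi ih => rw [Finset.sum_insert hi, Finset.sum_insert hi, Circuit.run_add, ih]

/-- Not knowing the state of the `S` cells costs a factor `2 ^ S`. -/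
lemma Circuit.trace_run_le_sum_basisState (bX : Fin l × Fin a → Bool)
    (bY : Fin r × Fin b → Bool) (o : Fin l × Fin r → Fin w → Bool) (c : Circuit l r a b w S)
    {ρ : Op S} (hρ : ρ.PosSemidef) (htr : ρ.trace.re ≤ 1) :
    (c.run bX bY o ρ).trace.re ≤ ∑ s, (c.run bX bY o (basisState s)).trace.re := by
  have h := trace_re_nonneg (c.run_posSemidef bX bY o (posSemidef_one_sub hρ htr))
  have h1 : c.run bX bY o 1 = c.run bX bY o (1 - ρ) + c.run bX bY o ρ := by
    rw [← Circuit.run_add, sub_add_cancel]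
  rw [show c.run bX bY o 1 = _ from by rw [← sum_basisState, Circuit.run_sum]] at h1
  have h2 := congrArg (fun σ => (Matrix.trace σ).re) h1
  simp only [trace_sum, Complex.re_sum, trace_add, Complex.add_re] at h2
  linarith

lemma Protocol.outputs_nodup {X Y Z : Type*} {l r S : ℕ} (Q : Protocol X Y Z l r S) : Q.circuit.outputs.Nodup :=
  List.nodup_iff_count_le_one.2 fun ij => by
    have := Q.output_once ij
    exact le_of_eq (by convert this)

lemma Protocol.length_outputs {X Y Z : Type*} {l r S : ℕ} (Q : Protocol X Y Z l r S) :
    Q.circuit.outputs.length = l * r := by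
  have h : Q.circuit.outputs.toFinset = Finset.univ := Finset.eq_univ_iff_forall.2 fun ij =>
    List.mem_toFinset.2 (List.count_pos_iff.1 (by rw [Q.output_once ij]; norm_num))
  rw [← List.toFinset_card_of_nodup Q.outputs_nodup, h]
  simp

variable {X Y Z : Type*} [Fintype X] [Fintype Y]

lemma Circuit.init_eq (S : ℕ) : Circuit.init S = basisState fun _ => false := rfl

/-- An upper bound for the success probability that is valid on average over the inputs bounds
`1 - ε`. -/
lemma one_sub_le_of_sum_le [Nonempty X] [Nonempty Y] {l r S : ℕ} {f : X → Y → Z} {ε C : ℝ} {Q : Protocol X Y Z l r S}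
    (hQ : Q.Computes f ε) (h : ∑ x : Fin l → X, ∑ y : Fin r → Y, Q.successProb f x y ≤
      C * ((Fintype.card (Fin l → X) : ℝ) * (Fintype.card (Fin r → Y) : ℝ))) : 1 - ε ≤ C := by
  have hN : (0 : ℝ) < (Fintype.card (Fin l → X) : ℝ) * (Fintype.card (Fin r → Y) : ℝ) := by
    have := Fintype.card_pos (α := Fin l → X); have := Fintype.card_pos (α := Fin r → Y)
    positivity
  have h' : ∑ x : Fin l → X, ∑ y : Fin r → Y, (1 - ε) ≤
      ∑ x : Fin l → X, ∑ y : Fin r → Y, Q.successProb f x y :=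
    Finset.sum_le_sum fun x _ => Finset.sum_le_sum fun y _ => hQ x y
  simp only [Finset.sum_const, Finset.card_univ, nsmul_eq_mul] at h'
  refine le_of_mul_le_mul_right ?_ hN
  linarith

variable [Fintype Z] [Nonempty X] [Nonempty Y]

/-- The average probability over all inputs that a segment with communication `n`, started in a
fixed basis state, makes its `k` outputs correctly. -/
theorem sum_trace_run_basisState_le (f : X → Y → Z) (encX : X ↪ (Fin a → Bool))
    (encY : Y ↪ (Fin b → Bool)) (encZ : Z ↪ (Fin w → Bool)) {own : Ownership S}
    {c : Circuit l r a b w S} (hc : c.Valid own) (hn : c.outputs.Nodup) (s : Basis S) :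
    ∑ x : Fin l → X, ∑ y : Fin r → Y, (c.run (fun p => encX (x p.1) p.2)
      (fun p => encY (y p.1) p.2) (fun ij => encZ (f (x ij.1) (y ij.2)))
        (basisState s)).trace.re ≤
    ((1 / (Fintype.card Z : ℝ)) ^ c.outputs.length + (Fintype.card Z : ℝ) ^ c.outputs.length *
      (16 ^ c.comm * (c.outputs.length * mdisc f))) *
      ((Fintype.card (Fin l → X) : ℝ) * (Fintype.card (Fin r → Y) : ℝ)) := by
  classical
  set N : ℝ := (Fintype.card (Fin l → X) : ℝ) * (Fintype.card (Fin r → Y) : ℝ) with hN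
  set L := c.outputs with hL
  set κ : ℝ := 1 / (Fintype.card Z : ℝ) with hκ
  set bX : (Fin l → X) → Fin l × Fin a → Bool := fun x p => encX (x p.1) p.2 with hbX
  set bY : (Fin r → Y) → Fin r × Fin b → Bool := fun y p => encY (y p.1) p.2 with hbY
  set P : (Fin l → X) → (Fin r → Y) → (Fin l × Fin r → Z) → ℝ := fun x y v =>
    (c.run (bX x) (bY y) (fun ij => encZ (v ij)) (basisState s)).trace.re with hP
  have hP0 : ∀ x y v, 0 ≤ P x y v := fun x y v =>
    trace_re_nonneg (c.run_posSemidef _ _ _ (basisState_posSemidef s))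
  have hI0 : ∀ x y v, 0 ≤ agreeInd f v L x y := fun x y v => by
    rw [agreeInd]; split_ifs <;> norm_num
  obtain ⟨x₀⟩ := ‹Nonempty X›
  obtain ⟨y₀⟩ := ‹Nonempty Y›
  -- The values outside `L` are irrelevant, but must not depend on the inputs, so that the sums over
  -- inputs and outputs can be exchanged.
  let u : Fin l × Fin r → Z := fun _ => f x₀ y₀
  have h1 : ∀ x y, P x y (fun ij => f (x ij.1) (y ij.2)) ≤
      assignSum L (fun v => P x y v * agreeInd f v L x y) u := by
    intro x y
    let v : Fin l × Fin r → Z := fun ij => if ij ∈ L then f (x ij.1) (y ij.2) else u ij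
    have hv : ∀ ij ∈ L, v ij = f (x ij.1) (y ij.2) := fun ij h => if_pos h
    refine le_trans (le_of_eq ?_) (le_assignSum (F := fun v => P x y v * agreeInd f v L x y)
      (fun v => mul_nonneg (hP0 x y v) (hI0 x y v)) (v := v) fun ij h => if_neg h)
    have e1 : agreeInd f v L x y = 1 := if_pos fun e he => (hv e he).symm
    have e2 : P x y v = P x y fun ij => f (x ij.1) (y ij.2) := by
      simp only [hP]
      rw [Circuit.run_congr]
      intro ij hij
      simp only [hv ij hij]
    simp only [e1, e2, mul_one]
  have h2 : ∀ v, ∑ x, ∑ y, P x y v * agreeInd f v L x y ≤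
      κ ^ L.length * (∑ x, ∑ y, P x y v) + 16 ^ c.comm * (L.length * (mdisc f * N)) := by
    intro v
    have := abs_sum_trace_run_le bX bY (fun ij => encZ (v ij))
      (fun x y => agreeInd f v L x y - κ ^ L.length) (L.length * (mdisc f * N))
      (fun α γ hα hγ => abs_sum_agreeInd_sub_le f α γ hα hγ v L hn) c own hc
      (fun q => (own q).getD .alice) (fun q P h => by simp [h]) (fun _ _ => basisState s)
      (productState_basisState _ s)
    refine le_trans (le_of_eq ?_) (add_le_add_right ((le_abs_self _).trans this) _)
    simp only [Finset.mul_sum, ← Finset.sum_add_distrib]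
    refine Finset.sum_congr rfl fun x _ => Finset.sum_congr rfl fun y _ => ?_
    simp only [hP]
    ring
  have h3 : ∀ x y, assignSum L (P x y) u ≤ 1 := fun x y =>
    (assignSum_trace_run_le encZ (bX x) (bY y) hc hn (basisState_posSemidef s) u).trans
      (by rw [trace_basisState]; simp)
  calc ∑ x, ∑ y, P x y (fun ij => f (x ij.1) (y ij.2))
      ≤ ∑ x, ∑ y, assignSum L (fun v => P x y v * agreeInd f v L x y) u :=
        Finset.sum_le_sum fun x _ => Finset.sum_le_sum fun y _ => h1 x y
    _ = assignSum L (fun v => ∑ x, ∑ y, P x y v * agreeInd f v L x y) u := by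
        simp only [assignSum_sum]
    _ ≤ assignSum L (fun v => κ ^ L.length * (∑ x, ∑ y, P x y v) +
          16 ^ c.comm * (L.length * (mdisc f * N))) u := assignSum_mono fun v _ => h2 v
    _ = κ ^ L.length * (∑ x, ∑ y, assignSum L (P x y) u) +
          (Fintype.card Z : ℝ) ^ L.length * (16 ^ c.comm * (L.length * (mdisc f * N))) := by
        rw [assignSum_add, assignSum_mul, assignSum_const]
        simp only [assignSum_sum]
    _ ≤ κ ^ L.length * N +
          (Fintype.card Z : ℝ) ^ L.length * (16 ^ c.comm * (L.length * (mdisc f * N))) := by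
        refine add_le_add_left (mul_le_mul_of_nonneg_left ?_ (by positivity)) _
        refine (Finset.sum_le_sum fun x _ => Finset.sum_le_sum fun y _ => h3 x y).trans ?_
        simp [hN]
    _ = _ := by ring

/-- An initial segment starts in a known state, so the factor `2 ^ S` of `one_sub_le_of_segment` is
absent. -/
theorem one_sub_le_of_prefix {l r S : ℕ} {f : X → Y → Z} {ε : ℝ} {Q : Protocol X Y Z l r S}
    (hQ : Q.Computes f ε) {c c' : Circuit l r Q.a Q.b Q.w S} (h : Q.circuit = c ++ c') :
    1 - ε ≤ (1 / (Fintype.card Z : ℝ)) ^ c.outputs.length +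
      (Fintype.card Z : ℝ) ^ c.outputs.length *
        (16 ^ c.comm * (c.outputs.length * mdisc f)) := by
  have hval := Q.valid
  have hnod := Q.outputs_nodup
  rw [h, Circuit.valid_append] at hval
  rw [h, Circuit.outputs_append] at hnod
  refine one_sub_le_of_sum_le hQ (le_trans ?_ (sum_trace_run_basisState_le f Q.encX Q.encY Q.encZ
    hval.1 hnod.of_append_left fun _ => false))
  refine Finset.sum_le_sum fun x _ => Finset.sum_le_sum fun y _ => ?_
  rw [Protocol.successProb, Circuit.outcomeProb, h, Circuit.run_append, Circuit.init_eq]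
  exact Circuit.trace_run_le hval.2 (Circuit.run_posSemidef _ _ _ _ (basisState_posSemidef _))

/-- The outputs of every segment are right with probability at least `1 - ε`, whatever happens
afterwards. -/
theorem one_sub_le_of_segment {l r S : ℕ} {f : X → Y → Z} {ε : ℝ} {Q : Protocol X Y Z l r S}
    (hQ : Q.Computes f ε) {c₁ c c' : Circuit l r Q.a Q.b Q.w S}
    (h : Q.circuit = c₁ ++ (c ++ c')) :
    1 - ε ≤ 2 ^ S * ((1 / (Fintype.card Z : ℝ)) ^ c.outputs.length +
      (Fintype.card Z : ℝ) ^ c.outputs.length *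
        (16 ^ c.comm * (c.outputs.length * mdisc f))) := by
  have hval := Q.valid
  have hnod := Q.outputs_nodup
  rw [h, Circuit.valid_append, Circuit.valid_append] at hval
  rw [h, Circuit.outputs_append, Circuit.outputs_append] at hnod
  have key := fun s => sum_trace_run_basisState_le f Q.encX Q.encY Q.encZ hval.2.1
    hnod.of_append_right.of_append_left s
  refine one_sub_le_of_sum_le hQ ?_
  calc ∑ x : Fin l → X, ∑ y : Fin r → Y, Q.successProb f x y
      ≤ ∑ x : Fin l → X, ∑ y : Fin r → Y, ∑ s, (c.run (fun p => Q.encX (x p.1) p.2)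
        (fun p => Q.encY (y p.1) p.2) (fun ij => Q.encZ (f (x ij.1) (y ij.2)))
          (basisState s)).trace.re := by
        refine Finset.sum_le_sum fun x _ => Finset.sum_le_sum fun y _ => ?_
        rw [Protocol.successProb, Circuit.outcomeProb, h, Circuit.run_append, Circuit.run_append,
          Circuit.init_eq]
        have hpos := c₁.run_posSemidef (fun p => Q.encX (x p.1) p.2)
          (fun p => Q.encY (y p.1) p.2) (fun ij => Q.encZ (f (x ij.1) (y ij.2)))
          (basisState_posSemidef fun _ => false)
        refine (Circuit.trace_run_le hval.2.2 (Circuit.run_posSemidef _ _ _ _ hpos)).trans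
          (Circuit.trace_run_le_sum_basisState _ _ _ _ hpos
            ((Circuit.trace_run_le hval.1 (basisState_posSemidef _)).trans ?_))
        rw [trace_basisState]; simp
    _ = ∑ s, ∑ x : Fin l → X, ∑ y : Fin r → Y, (c.run (fun p => Q.encX (x p.1) p.2)
        (fun p => Q.encY (y p.1) p.2) (fun ij => Q.encZ (f (x ij.1) (y ij.2)))
          (basisState s)).trace.re := by
        exact (Finset.sum_congr rfl fun x _ => Finset.sum_comm).trans Finset.sum_comm
    _ ≤ _ := by
        refine (Finset.sum_le_sum fun s _ => key s).trans (le_of_eq ?_)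
        simp only [Finset.sum_const, Finset.card_univ, nsmul_eq_mul]
        simp
        ring

end Segments

/-! ### Cutting a protocol into segments -/

section Cutting

variable {l r a b w S : ℕ}

lemma Gate.cost_le (g : Gate l r a b w S) : g.cost ≤ S := by
  cases g with
  | send P q => exact q.pos
  | output P reg ij => simpa [Gate.cost] using Fintype.card_le_of_embedding reg
  | _ => exact Nat.zero_le _

namespace Circuit

lemma width_le {c : Circuit l r a b w S} (hc : c.outputs ≠ []) : w ≤ S := by
  obtain ⟨ij, hij⟩ := List.exists_mem_of_ne_nil _ hc
  obtain ⟨g, -, hg⟩ := List.mem_filterMap.1 hij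
  cases g with
  | output P reg ij => simpa using Fintype.card_le_of_embedding reg
  | _ => simp [Gate.label] at hg

lemma exists_prefix_length_outputs_eq {c : Circuit l r a b w S} {k : ℕ}
    (hk : k ≤ c.outputs.length) : ∃ c₁ c₂, c = c₁ ++ c₂ ∧ c₁.outputs.length = k := by
  induction c generalizing k with
  | nil => exact ⟨[], [], rfl, (Nat.le_zero.1 hk).symm⟩
  | cons g c ih =>
    rcases k with _ | k
    · exact ⟨[], g :: c, rfl, rfl⟩
    rcases hl : g.label with _ | ij
    · rw [outputs_cons_none hl] at hk
      obtain ⟨c₁, c₂, rfl, h⟩ := ih hk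
      exact ⟨g :: c₁, c₂, rfl, by rw [outputs_cons_none hl, h]⟩
    · rw [outputs_cons_some hl, List.length_cons] at hk
      obtain ⟨c₁, c₂, rfl, h⟩ := ih (Nat.le_of_succ_le_succ hk)
      exact ⟨g :: c₁, c₂, rfl, by rw [outputs_cons_some hl, List.length_cons, h]⟩

/-- A maximal prefix with communication at most `n`: unless it is everything, the next gate, of cost at
most `S`, exceeds the bound. -/
lemma exists_prefix_comm_le (c : Circuit l r a b w S) (n : ℕ) :
    ∃ p t, c = p ++ t ∧ p.comm ≤ n ∧ (t = [] ∨ n < p.comm + S) := by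
  induction c generalizing n with
  | nil => exact ⟨[], [], rfl, Nat.zero_le _, Or.inl rfl⟩
  | cons g c ih =>
    by_cases hg : g.cost ≤ n
    · obtain ⟨p, t, rfl, h1, h2⟩ := ih (n - g.cost)
      refine ⟨g :: p, t, rfl, by rw [comm_cons]; omega, h2.imp_right fun h => ?_⟩
      rw [comm_cons]; omega
    · have := g.cost_le
      exact ⟨[], g :: c, rfl, Nat.zero_le _, Or.inr (by omega)⟩

/-- If segments with communication at most `n` contain at most `K` outputs, then outputs need much
communication: every segment of a greedy decomposition uses at least `n + 1 - S`. -/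
lemma length_outputs_mul_le {n K : ℕ} (hn : S ≤ n) (c : Circuit l r a b w S)
    (h : ∀ c₁ c₂ c₃, c = c₁ ++ (c₂ ++ c₃) → c₂.comm ≤ n → c₂.outputs.length ≤ K) :
    c.outputs.length * (n + 1 - S) ≤ K * (c.comm + (n + 1 - S)) := by
  obtain ⟨p, t, rfl, hp, ht⟩ := exists_prefix_comm_le c n
  have h1 := h [] p t rfl hp
  rcases ht with rfl | ht
  · rw [List.append_nil]
    exact Nat.mul_le_mul h1 (Nat.le_add_left _ _)
  · have hm : n + 1 - S ≤ p.comm := by omega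
    have hne : p ≠ [] := by
      rintro rfl
      have : comm ([] : Circuit l r a b w S) = 0 := rfl
      omega
    have h2 := length_outputs_mul_le hn t fun c₁ c₂ c₃ hc => h (p ++ c₁) c₂ c₃ (by
      rw [hc, List.append_assoc])
    rw [outputs_append, comm_append, List.length_append, add_mul]
    have h3 := Nat.mul_le_mul h1 hm
    calc p.outputs.length * (n + 1 - S) + t.outputs.length * (n + 1 - S)
        ≤ K * p.comm + K * (t.comm + (n + 1 - S)) := add_le_add h3 h2
      _ = _ := by ring
termination_by c.length
decreasing_by
  subst_vars
  have := List.length_pos_of_ne_nil hne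
  simp only [List.length_append]
  omega

end Circuit

end Cutting

/-! ### The tradeoff -/

section Tradeoff

variable {X Y Z : Type*} [Fintype X] [Fintype Y] [Fintype Z] [Nonempty X] [Nonempty Y]
  {f : X → Y → Z} {d ε : ℝ} {l r S : ℕ} {Q : Protocol X Y Z l r S}

/-- There is a least `K` such that `K + 1` guessed outputs are right with probability at most
`2 ^ (-S - 2)`. -/
lemma exists_output_bound {M : ℕ} (hM : 2 ≤ M) (S : ℕ) :
    ∃ K : ℕ, M ^ K < 2 ^ (S + 2) ∧ 2 ^ (S + 2) ≤ M ^ (K + 1) := by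
  have hex : ∃ k, 2 ^ (S + 2) ≤ M ^ k := ⟨S + 2, Nat.pow_le_pow_left hM _⟩
  have hpos : Nat.find hex ≠ 0 := by
    intro h0
    have := Nat.find_spec hex
    rw [h0, pow_zero] at this
    have h2 : 2 ^ (S + 2) = 4 * 2 ^ S := by ring
    have h3 := Nat.one_le_two_pow (n := S)
    omega
  obtain ⟨K, hK⟩ := Nat.exists_eq_succ_of_ne_zero hpos
  refine ⟨K, not_le.1 (Nat.find_min hex (by omega)), ?_⟩
  have := Nat.find_spec hex
  rwa [hK] at this

/-- A segment with little communication makes few outputs. -/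
lemma length_outputs_le_of_segment (hf : mdisc f ≤ (2 : ℝ) ^ (-d)) (hQ : Q.Computes f ε)
    (hε : ε < 1 / 2) (hZ : Fintype.card Z ≤ 2 ^ S) {K : ℕ}
    (hK1 : Fintype.card Z ^ K < 2 ^ (S + 2)) (hK2 : 2 ^ (S + 2) ≤ Fintype.card Z ^ (K + 1))
    {c₁ c c' : Circuit l r Q.a Q.b Q.w S} (h : Q.circuit = c₁ ++ (c ++ c'))
    (hd : 5 * (S : ℝ) + 6 + 4 * c.comm ≤ d) : c.outputs.length ≤ K := by
  by_contra hlen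
  obtain ⟨p, t, rfl, hp⟩ := Circuit.exists_prefix_length_outputs_eq (k := K + 1)
    (Nat.succ_le_of_lt (not_le.1 hlen))
  rw [Circuit.comm_append] at hd
  push_cast at hd
  have key := one_sub_le_of_segment hQ (c₁ := c₁) (c := p) (c' := t ++ c')
    (by rw [h, List.append_assoc])
  rw [hp] at key
  set M : ℝ := (Fintype.card Z : ℝ) with hM
  have hup : M ^ (K + 1) ≤ (2 : ℝ) ^ (2 * S + 2) := by
    have : Fintype.card Z ^ (K + 1) ≤ 2 ^ (2 * S + 2) := by
      calc Fintype.card Z ^ (K + 1) = Fintype.card Z ^ K * Fintype.card Z := pow_succ _ _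
        _ ≤ 2 ^ (S + 2) * 2 ^ S := Nat.mul_le_mul hK1.le hZ
        _ = 2 ^ (2 * S + 2) := by rw [← pow_add]; congr 1; ring
    rw [hM]; exact_mod_cast this
  have hlow : (2 : ℝ) ^ (S + 2) ≤ M ^ (K + 1) := by rw [hM]; exact_mod_cast hK2
  have hMpos : 0 < M ^ (K + 1) := lt_of_lt_of_le (by positivity) hlow
  have hlenR : ((K + 1 : ℕ) : ℝ) ≤ (2 : ℝ) ^ (2 * S + 2) := by
    have h2 : 2 ≤ Fintype.card Z := by
      by_contra h2
      have : Fintype.card Z ^ (K + 1) ≤ 1 := Nat.pow_le_one_iff (by omega) |>.2 (by omega)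
      have h3 := Nat.one_le_two_pow (n := S)
      have h4 : 2 ^ (S + 2) = 4 * 2 ^ S := by ring
      omega
    refine le_trans ?_ hup
    rw [hM]
    exact_mod_cast (Nat.lt_pow_self (n := K + 1) (lt_of_lt_of_le one_lt_two h2)).le
  have hfirst : (2 : ℝ) ^ S * (1 / M) ^ (K + 1) ≤ 1 / 4 := by
    rw [div_pow, one_pow, mul_one_div, div_le_div_iff₀ hMpos (by norm_num)]
    calc (2 : ℝ) ^ S * 4 = 2 ^ (S + 2) := by ring
      _ ≤ 1 * M ^ (K + 1) := by rw [one_mul]; exact hlow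
  have hsecond : (2 : ℝ) ^ S * (M ^ (K + 1) * (16 ^ p.comm * ((K + 1 : ℕ) * mdisc f))) ≤
      1 / 4 := by
    calc (2 : ℝ) ^ S * (M ^ (K + 1) * (16 ^ p.comm * ((K + 1 : ℕ) * mdisc f)))
        ≤ (2 : ℝ) ^ S * (2 ^ (2 * S + 2) * (16 ^ p.comm * (2 ^ (2 * S + 2) * 2 ^ (-d)))) := by
          have := mdisc_nonneg f
          gcongr
      _ = (2 : ℝ) ^ (5 * (S : ℝ) + 4 + 4 * p.comm - d) := by
          rw [show (16 : ℝ) = 2 ^ 4 by norm_num, ← pow_mul]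
          simp only [← Real.rpow_natCast]
          rw [← Real.rpow_add two_pos, ← Real.rpow_add two_pos, ← Real.rpow_add two_pos,
            ← Real.rpow_add two_pos]
          congr 1
          push_cast
          ring
      _ ≤ (2 : ℝ) ^ (-2 : ℝ) := by
          refine Real.rpow_le_rpow_of_exponent_le one_le_two ?_
          have : (0 : ℝ) ≤ (t.comm : ℝ) := Nat.cast_nonneg _
          linarith
      _ = 1 / 4 := by norm_num [Real.rpow_neg]
  rw [mul_add] at key
  linarith

/-- A protocol that communicates little does not even get one output right. -/
lemma not_computes_of_comm_small (hf : mdisc f ≤ (2 : ℝ) ^ (-d)) (hQ : Q.Computes f ε)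
    (hZ2 : 2 ≤ Fintype.card Z) (hZ : Fintype.card Z ≤ 2 ^ S) (hlr : 1 ≤ l * r)
    (hd : (2 : ℝ) ^ ((S : ℝ) + 4 * Q.comm - d) < 1 / 2 - ε) : False := by
  obtain ⟨p, t, hpt, hp⟩ := Circuit.exists_prefix_length_outputs_eq
    (c := Q.circuit) (k := 1) (by rw [Q.length_outputs]; exact hlr)
  have key := one_sub_le_of_prefix hQ hpt
  have hcomm : p.comm ≤ Q.comm := by
    rw [Protocol.comm, hpt, Circuit.comm_append]; exact Nat.le_add_right _ _
  rw [hp, pow_one, pow_one, Nat.cast_one, one_mul] at key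
  have hM2 : (2 : ℝ) ≤ (Fintype.card Z : ℝ) := by exact_mod_cast hZ2
  have hM : (Fintype.card Z : ℝ) ≤ 2 ^ S := by exact_mod_cast hZ
  have h1 : 1 / (Fintype.card Z : ℝ) ≤ 1 / 2 := one_div_le_one_div_of_le two_pos hM2
  have h2 : (Fintype.card Z : ℝ) * (16 ^ p.comm * mdisc f) ≤
      (2 : ℝ) ^ ((S : ℝ) + 4 * Q.comm - d) := by
    calc (Fintype.card Z : ℝ) * (16 ^ p.comm * mdisc f)
        ≤ 2 ^ S * (16 ^ Q.comm * 2 ^ (-d)) := by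
          have := mdisc_nonneg f
          gcongr
          norm_num
      _ = _ := by
          rw [show (16 : ℝ) = 2 ^ 4 by norm_num, ← pow_mul]
          simp only [← Real.rpow_natCast]
          rw [← Real.rpow_add two_pos, ← Real.rpow_add two_pos]
          congr 1
          push_cast
          ring
  linarith

/-- The tradeoff, with a constant depending on a bound `D` beyond which `2 ^ (-d / 4)` is smaller
than the advantage `1 / 2 - ε` over guessing. -/
theorem tradeoff (hε : ε < 1 / 2) {D : ℝ} (hD0 : 0 ≤ D)
    (hD : (2 : ℝ) ^ (-D / 4) < 1 / 2 - ε) (hf : mdisc f ≤ (2 : ℝ) ^ (-d))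
    (hQ : Q.Computes f ε) :
    1 / (100 + D) * (d * l * r * Real.logb 2 (Fintype.card Z)) ≤ (Q.comm : ℝ) * S := by
  set lam := Real.logb 2 (Fintype.card Z) with hlam
  have hCS : 0 ≤ (Q.comm : ℝ) * S := by positivity
  have hZne : Nonempty Z := by
    obtain ⟨x⟩ := ‹Nonempty X›
    obtain ⟨y⟩ := ‹Nonempty Y›
    exact ⟨f x y⟩
  have hZ1 : 1 ≤ Fintype.card Z := Fintype.card_pos
  rw [one_div, inv_mul_le_iff₀ (by positivity)]
  have hlam0 : 0 ≤ lam := Real.logb_nonneg one_lt_two (by exact_mod_cast hZ1)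
  rcases Nat.eq_zero_or_pos (l * r) with hlr | hlr
  · have : (l : ℝ) * r = 0 := by exact_mod_cast hlr
    rw [mul_assoc d, this]
    simp only [mul_zero, zero_mul]
    positivity
  rcases hZ1.eq_or_lt with hZ | hZ2
  · rw [hlam, ← hZ]
    simp only [Nat.cast_one, Real.logb_one, mul_zero]
    positivity
  rcases le_or_gt d 0 with hd0 | hd0
  · have h1 : d * l * r * lam = d * (l * r * lam) := by ring
    have h2 : 0 ≤ (l : ℝ) * r * lam := by positivity
    rw [h1]
    exact (mul_nonpos_of_nonpos_of_nonneg hd0 h2).trans (by positivity)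
  have hne : Q.circuit.outputs ≠ [] := by
    rw [← List.length_pos_iff_ne_nil, Q.length_outputs]; exact hlr
  have hwS : Q.w ≤ S := Circuit.width_le hne
  have hZw : Fintype.card Z ≤ 2 ^ Q.w := by
    simpa using Fintype.card_le_of_embedding Q.encZ
  have hZS : Fintype.card Z ≤ 2 ^ S := hZw.trans (Nat.pow_le_pow_right two_pos hwS)
  have hS : 1 ≤ S := by
    by_contra h
    have : S = 0 := by omega
    rw [this, pow_zero] at hZS
    omega
  have hSR : (1 : ℝ) ≤ S := by exact_mod_cast hS
  have hlamw : lam ≤ Q.w := by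
    rw [hlam, Real.logb_le_iff_le_rpow one_lt_two (by exact_mod_cast hZ1), Real.rpow_natCast]
    exact_mod_cast hZw
  have htriv : (l : ℝ) * r * lam ≤ Q.comm := by
    have h1 := Q.circuit.length_outputs_mul_le_comm
    rw [Q.length_outputs] at h1
    calc (l : ℝ) * r * lam ≤ l * r * Q.w := by gcongr
      _ ≤ Q.comm := by exact_mod_cast h1
  have hx0 : 0 ≤ (l : ℝ) * r * lam := by positivity
  have hassoc : d * l * r * lam = d * (l * r * lam) := by ring
  rw [hassoc]
  rcases le_or_gt d (100 * S + D) with hd | hd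
  · -- The outputs alone need enough communication.
    calc d * (l * r * lam) ≤ (100 * S + D) * Q.comm := by gcongr
      _ ≤ (100 + D) * S * Q.comm := by
          gcongr
          nlinarith
      _ = _ := by ring
  have hdS : 100 * (S : ℝ) < d := by linarith
  -- Segments with communication at most `n`, so that `16 ^ n ≤ 2 ^ (d / 2)`.
  set n : ℕ := ⌊d / 8⌋₊ with hn
  have hn1 : (n : ℝ) ≤ d / 8 := Nat.floor_le (by positivity)
  have hn2 : d / 8 < n + 1 := Nat.lt_floor_add_one _
  have hSn : S ≤ n := Nat.le_floor (by linarith)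
  obtain ⟨K, hK1, hK2⟩ := exists_output_bound hZ2 S
  have hseg := Circuit.length_outputs_mul_le hSn Q.circuit fun c₁ c₂ c₃ hc hc₂ =>
    length_outputs_le_of_segment hf hQ hε hZS hK1 hK2 hc (by
      have : (c₂.comm : ℝ) ≤ n := by exact_mod_cast hc₂
      linarith)
  rw [Q.length_outputs] at hseg
  have hbig : n < Q.comm := by
    by_contra h
    have h1 : (Q.comm : ℝ) ≤ n := by exact_mod_cast not_lt.1 h
    refine not_computes_of_comm_small hf hQ hZ2 hZS hlr (lt_of_le_of_lt ?_ hD)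
    refine Real.rpow_le_rpow_of_exponent_le one_le_two ?_
    linarith
  -- All segments but the last one have communication at least `m`.
  set m : ℕ := n + 1 - S with hm
  have hmR : (m : ℝ) = n + 1 - S := by
    rw [hm, Nat.cast_sub (by omega)]; push_cast; ring
  have hmd : d ≤ 10 * m := by rw [hmR]; linarith
  have hmC : (m : ℝ) ≤ Q.comm := by exact_mod_cast (show m ≤ Q.comm by omega)
  have hKlam : K * lam ≤ 3 * S := by
    have h1 : Real.logb 2 ((Fintype.card Z : ℝ) ^ K) ≤ Real.logb 2 ((2 : ℝ) ^ (S + 2)) := by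
      refine Real.logb_le_logb_of_le one_lt_two (by positivity) ?_
      exact_mod_cast hK1.le
    rw [Real.logb_pow, Real.logb_pow, Real.logb_self_eq_one one_lt_two] at h1
    push_cast at h1
    linarith
  have hsegR : (l : ℝ) * r * m ≤ K * (Q.comm + m) := by exact_mod_cast hseg
  calc d * (l * r * lam) ≤ 10 * m * (l * r * lam) := by gcongr
    _ = 10 * lam * (l * r * m) := by ring
    _ ≤ 10 * lam * (K * (Q.comm + m)) := by gcongr
    _ = 10 * (K * lam) * (Q.comm + m) := by ring
    _ ≤ 10 * (3 * S) * (Q.comm + Q.comm) := by gcongr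
    _ = 60 * (Q.comm * S) := by ring
    _ ≤ (100 + D) * (Q.comm * S) := by gcongr; linarith

end Tradeoff

end CommSpace

end

theorem theorem3 (ε : ℝ) (hε0 : 0 ≤ ε) (hε : ε < 1 / 2) :
    ∃ c : ℝ, 0 < c ∧
      (∀ (X : Type u₁) (Y : Type u₂) (Z : Type u₃) [Fintype X] [Fintype Y] [Fintype Z] [Nonempty X] [Nonempty Y]
        (f : X → Y → Z) (d : ℝ), CommSpace.mdisc f ≤ (2 : ℝ) ^ (-d) →
        ∀ (l r S : ℕ) (Q : CommSpace.Protocol X Y Z l r S), Q.Computes f ε →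
          c * (d * l * r * Real.logb 2 (Fintype.card Z)) ≤ (Q.comm : ℝ) * S) ∧
      (∀ (X : Type u₁) (Y : Type u₂) [Fintype X] [Fintype Y] [Nonempty X] [Nonempty Y]
        (f : X → Y → Bool) (d : ℝ), CommSpace.disc f ≤ (2 : ℝ) ^ (-d) →
        ∀ (l r S : ℕ) (Q : CommSpace.Protocol X Y Bool l r S), Q.Computes f ε →
          c * (d * l * r) ≤ (Q.comm : ℝ) * S) := by
  obtain ⟨m, hm⟩ : ∃ m : ℕ, (1 / 2 : ℝ) ^ m < 1 / 2 - ε :=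
    exists_pow_lt_of_lt_one (by linarith) (by norm_num)
  have hD : (2 : ℝ) ^ (-(4 * m : ℝ) / 4) < 1 / 2 - ε := by
    rw [show -(4 * m : ℝ) / 4 = -m by ring, Real.rpow_neg two_pos.le, Real.rpow_natCast, ← inv_pow]
    simpa using hm
  have hD0 : (0 : ℝ) ≤ 4 * m := by positivity
  refine ⟨1 / (100 + 4 * m), by positivity, ?_, ?_⟩
  · intro X Y Z _ _ _ _ _ f d hf l r S Q hQ
    exact CommSpace.tradeoff hε hD0 hD hf hQ
  · intro X Y _ _ _ _ f d hf l r S Q hQ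
    have h := CommSpace.tradeoff hε hD0 hD ((CommSpace.mdisc_le_disc f).trans hf) hQ
    simpa using h
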